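/- For $\alpha\in(1,2]$ put $\beta=\alpha/(\alpha-1)$ and, for $a>0$, $x\in\mathbb R$, $$H_{a,\alpha}(x)=\begin{cases}\dfrac{x^2}{2}&\text{if }|x|\le a,\\[1mm] a^{2-\beta}\dfrac{|x|^\beta}{\beta}+a^2\dfrac{\beta-2}{2\beta}&\text{if }|x|\ge a.\end{cases}$$ A probability measure $\mu$ on $\mathbb R$ is said to satisfy a logarithmic Sobolev inequality of function $H_{a,\alpha}$ if there is a constant $C\in(0,\infty)$ such that for every $C^\infty$ function $f:\mathbb R\to\mathbb R$ with $f\in L^2(\mu)$, $$\int f^2\log\frac{f^2}{\int f^2\,d\mu}\,d\mu\;\le\; C\int H_{a,\alpha}\!\left(\frac{f'}{f}\right)f^2\,d\mu ,$$ where both sides may be $+\infty$, and the integrand on the right is taken to be $0$ at the points where $f=0$ (that is, $f'/f=\infty$ there, including $0/0=\infty$, with $H_{a,\alpha}(\infty)=\infty$ and $\infty\cdot 0=0$). For $\alpha\in(1,2]$ and $b\in\mathbb R$ consider the measures on $\mathbb R$ $$d\tau_\alpha(x)=\exp\left(-|x|^\alpha-|x|^{\alpha-1}\cos x\right)\frac{dx}{Z_\alpha},\qquad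 d\gamma_{\alpha,b}(x)=(1+x)^b e^{-x^\alpha}\mathbf 1_{x\ge0}\frac{dx}{Z_{\alpha,b}},$$ where $Z_\alpha$ and $Z_{\alpha,b}$ are the integrals of the respective densities. **Proposition.** There exists $a>0$ such that for every $\alpha\in(1,2]$ and every $b\in\mathbb R$, $\tau_\alpha$ and $\gamma_{\alpha,b}$ are probability measures and each of them satisfies a logarithmic Sobolev inequality of function $H_{a,\alpha}$ (with a constant $C$ that may depend on the measure). -/

import Mathlib

open MeasureTheory Set
open scoped ENNReal ContDiff

noncomputable section

namespace ModLSI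

/-- The function `H_{a,α}` on `ℝ`, for `1 < α ≤ 2` and `a > 0`. With `β = α / (α - 1)` the exponent
conjugate to `α`, it is `x² / 2` for `|x| ≤ a` and
`a^(2-β) |x|^β / β + a² (β - 2) / (2β)` for `|x| ≥ a` (the two formulas agree at `|x| = a`). -/
def H (a α x : ℝ) : ℝ :=
  if |x| ≤ a then x ^ 2 / 2
  else a ^ (2 - α.conjExponent) * (|x| ^ α.conjExponent / α.conjExponent)
    + a ^ 2 * ((α.conjExponent - 2) / (2 * α.conjExponent))

/-- The entropy `Ent_μ(g) = ∫ g log (g / ∫ g dμ) dμ` of a nonnegative `μ`-integrable function `g`,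
for a probability measure `μ`. As `g log (g / ∫ g dμ)` is bounded below, this integral always
exists in `]-∞, +∞]`, and it is `+∞` exactly when the integrand is not integrable. -/
def entropy (μ : Measure ℝ) (g : ℝ → ℝ) : EReal :=
  open Classical in
  if Integrable (fun x => g x * Real.log (g x / ∫ y, g y ∂μ)) μ then
    ((∫ x, g x * Real.log (g x / ∫ y, g y ∂μ) ∂μ : ℝ) : EReal)
  else ⊤

/-- `H_{a,α}(f'/f)` as a function with values in `[0, +∞]`: where `f` vanishes the quotient `f'/f`
is infinite (also when `f'` vanishes there: `0 / 0 = ∞`), and `H_{a,α}(∞) = ∞`. -/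
def HLogDeriv (a α : ℝ) (f : ℝ → ℝ) (x : ℝ) : ℝ≥0∞ :=
  open Classical in
  if f x = 0 then ⊤ else ENNReal.ofReal (H a α (deriv f x / f x))

/-- The energy `∫ H_{a,α}(f'/f) f² dμ ∈ [0, +∞]`, with the convention `∞ · 0 = 0` of measure theory,
so that the set where `f` vanishes does not contribute. -/
def energy (a α : ℝ) (μ : Measure ℝ) (f : ℝ → ℝ) : ℝ≥0∞ :=
  ∫⁻ x, HLogDeriv a α f x * ENNReal.ofReal (f x ^ 2) ∂μ

/-- `LSI_{a,α}(C)`: `Ent_μ(f²) ≤ C ∫ H_{a,α}(f'/f) f² dμ` for every `C^∞` function `f` on `ℝ` that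
is in `L²(μ)`. Both sides may be `+∞`. -/
def SatisfiesLSI (a α C : ℝ) (μ : Measure ℝ) : Prop :=
  ∀ f : ℝ → ℝ, ContDiff ℝ ∞ f → MemLp f 2 μ →
    entropy μ (fun x => f x ^ 2) ≤ ((ENNReal.ofReal C * energy a α μ f : ℝ≥0∞) : EReal)

/-- The unnormalised density `exp (-|x|^α - |x|^(α-1) cos x)` of `τ_α`. -/
def tauDensity (α x : ℝ) : ℝ :=
  Real.exp (-|x| ^ α - |x| ^ (α - 1) * Real.cos x)

/-- The measure `dτ_α(x) = exp (-|x|^α - |x|^(α-1) cos x) dx / Z_α`, where `Z_α` is the total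
integral of the density. -/
def tau (α : ℝ) : Measure ℝ :=
  volume.withDensity fun x => ENNReal.ofReal (tauDensity α x / ∫ y, tauDensity α y)

/-- The unnormalised density `(1 + x)^b exp (-x^α)`, `x ≥ 0`, of `γ_{α,b}`. -/
def gammaDensity (α b x : ℝ) : ℝ :=
  (1 + x) ^ b * Real.exp (-x ^ α)

/-- The measure `dγ_{α,b}(x) = (1 + x)^b exp (-x^α) 1_{x ≥ 0} dx / Z_{α,b}`, where `Z_{α,b}` is the
integral of the density over `[0, ∞[`. -/
def gamma (α b : ℝ) : Measure ℝ :=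
  (volume.restrict (Ici (0 : ℝ))).withDensity fun x =>
    ENNReal.ofReal (gammaDensity α b x / ∫ y in Ici (0 : ℝ), gammaDensity α b y)

end ModLSI

end

/-!
Write `β = α / (α - 1)`. By Young's inequality the weighted norm of `u^{1/β}` in `W^{1,β}` controls
`∫ (1 + |x|)^α u` and, up to a factor `exp (C (1 + |x|)^α)`, the values of `u`: on a half-line with
weight `exp (-V)`, where `x V' x ≥ c (1 + x)^α - B`, one integrates the derivatives of
`x u exp (-V)` and of `u exp (-K (1 + x)^α)`. With `u = f²`, the second bound turns
`log (u / t)` into a multiple of `1 + (1 + |x|)^α` and the first bound integrates it against `u`,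
so that the entropy of `f²` is bounded by the energy of `f` plus a multiple of `∫ f²`.

To remove `∫ f²`: if `∫ (f - f 0)² ≥ f(0)²`, the Hardy inequality suffices. Otherwise let
`g = f / f 0`. Now `s² log s² - s² + 1` is at most a multiple of `(s - 1)²` for bounded `s`, and
large values of `g` are handled by applying the previous bounds to the truncation
`((|g|^{2/β} - 1)₊)^β`, which is at most `(g - 1)²` because `β ≥ 2`.

The bounds are stable under adding the reflected measure, which gives the case of even weights on
the line; and `H_{a,α}(t)` is comparable to `t² + |t|^β` whatever `a > 0`.
-/

namespace ModLSI

theorem ofReal_integral_le_lintegral {X : Type*} [MeasurableSpace X] {μ : Measure X} {F : X → ℝ}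
    (hF : Integrable F μ) :
    ENNReal.ofReal (∫ x, F x ∂μ) ≤ ∫⁻ x, ENNReal.ofReal (F x) ∂μ := by
  rw [integral_eq_lintegral_pos_part_sub_lintegral_neg_part hF]
  exact (ENNReal.ofReal_le_ofReal (sub_le_self _ ENNReal.toReal_nonneg)).trans
    ENNReal.ofReal_toReal_le

theorem setLIntegral_Ioi_le_of_forall_Ioc {a : ℝ} {F : ℝ → ℝ≥0∞} {A : ℝ≥0∞}
    (h : ∀ R > a, ∫⁻ x in Ioc a R, F x ≤ A) : ∫⁻ x in Ioi a, F x ≤ A := by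
  have hmono : Monotone fun n : ℕ => Ioc a (a + 1 + n) := fun m n hmn =>
    Ioc_subset_Ioc_right (by gcongr)
  have hunion : Ioi a = ⋃ n : ℕ, Ioc a (a + 1 + n) := by
    ext x
    simp only [mem_Ioi, mem_iUnion, mem_Ioc]
    refine ⟨fun hx => ?_, fun ⟨n, hx⟩ => hx.1⟩
    obtain ⟨n, hn⟩ := exists_nat_ge (x - a - 1)
    exact ⟨n, hx, by linarith⟩
  rw [hunion, setLIntegral_iUnion_of_directed _ hmono.directed_le]
  exact iSup_le fun n => h _ (by have := n.cast_nonneg (α := ℝ); linarith)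

theorem lintegral_Ioi_le_of_deriv_add_le {a b : ℝ} {p p' F G : ℝ → ℝ}
    (hp : ContinuousOn p (Ici a)) (hderiv : ∀ x ∈ Ioi a, HasDerivAt p (p' x) x)
    (hp' : ContinuousOn p' (Ici a)) (hF : ContinuousOn F (Ici a)) (hF0 : ∀ x ∈ Ioi a, 0 ≤ F x)
    (hle : ∀ x ∈ Ioi a, p' x + F x ≤ G x) (hend : ∀ x ∈ Ioi a, p a ≤ p x + b) :
    ∫⁻ x in Ioi a, ENNReal.ofReal (F x) ≤
      (∫⁻ x in Ioi a, ENNReal.ofReal (G x)) + ENNReal.ofReal b := by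
  refine setLIntegral_Ioi_le_of_forall_Ioc fun R hR => ?_
  have hsub : Icc a R ⊆ Ici a := Icc_subset_Ici_self
  have ip' : IntegrableOn p' (Ioc a R) :=
    (hp'.mono hsub).integrableOn_Icc.mono_set Ioc_subset_Icc_self
  have iF : IntegrableOn F (Ioc a R) :=
    (hF.mono hsub).integrableOn_Icc.mono_set Ioc_subset_Icc_self
  have ftc : ∫ x in Ioc a R, p' x = p R - p a := by
    rw [← intervalIntegral.integral_of_le hR.le]
    exact intervalIntegral.integral_eq_sub_of_hasDerivAt_of_le hR.le (hp.mono hsub)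
      (fun x hx => hderiv x hx.1) ((intervalIntegrable_iff_integrableOn_Ioc_of_le hR.le).2 ip')
  calc ∫⁻ x in Ioc a R, ENNReal.ofReal (F x)
      = ENNReal.ofReal (∫ x in Ioc a R, F x) :=
        (ofReal_integral_eq_lintegral_ofReal iF
          (ae_restrict_of_forall_mem measurableSet_Ioc fun x hx => hF0 x hx.1)).symm
    _ ≤ ENNReal.ofReal ((∫ x in Ioc a R, (p' x + F x)) + b) := by
        rw [integral_add ip' iF, ftc]
        exact ENNReal.ofReal_le_ofReal (by linarith [hend R hR])
    _ ≤ ENNReal.ofReal (∫ x in Ioc a R, (p' x + F x)) + ENNReal.ofReal b :=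
        ENNReal.ofReal_add_le
    _ ≤ (∫⁻ x in Ioc a R, ENNReal.ofReal (p' x + F x)) + ENNReal.ofReal b := by
        gcongr
        exact ofReal_integral_le_lintegral (ip'.add iF)
    _ ≤ (∫⁻ x in Ioc a R, ENNReal.ofReal (G x)) + ENNReal.ofReal b := by
        gcongr ?_ + _
        exact setLIntegral_mono' measurableSet_Ioc fun x hx =>
          ENNReal.ofReal_le_ofReal (hle x hx.1)
    _ ≤ _ := by
        gcongr
        exact Ioc_subset_Ioi_self

theorem ofReal_sub_le_lintegral_abs_deriv {a : ℝ} {p p' : ℝ → ℝ}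
    (hderiv : ∀ x ∈ Ioi a, HasDerivAt p (p' x) x) (hp' : ContinuousOn p' (Ioi a)) {x y : ℝ}
    (hx : a < x) (hy : a < y) :
    ENNReal.ofReal (p x - p y) ≤ ∫⁻ t in Ioi a, ENNReal.ofReal |p' t| := by
  have hsub : uIcc y x ⊆ Ioi a := fun t ht => (lt_min hy hx).trans_le ht.1
  have hint : IntervalIntegrable p' volume y x := (hp'.mono hsub).intervalIntegrable
  have hint' : IntegrableOn p' (uIoc y x) := intervalIntegrable_iff.1 hint
  calc ENNReal.ofReal (p x - p y) = ENNReal.ofReal (∫ t in y..x, p' t) := by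
        rw [intervalIntegral.integral_eq_sub_of_hasDerivAt
          (fun t ht => hderiv t (hsub ht)) hint]
    _ ≤ ENNReal.ofReal (∫ t in uIoc y x, |p' t|) := ENNReal.ofReal_le_ofReal <|
        (Real.le_norm_self _).trans intervalIntegral.norm_integral_le_integral_norm_uIoc
    _ = ∫⁻ t in uIoc y x, ENNReal.ofReal |p' t| :=
        ofReal_integral_eq_lintegral_ofReal hint'.abs (ae_of_all _ fun t => abs_nonneg _)
    _ ≤ _ := lintegral_mono_set (uIoc_subset_uIcc.trans hsub)

theorem ofReal_le_lintegral_add_lintegral_abs_deriv {a : ℝ} {p p' : ℝ → ℝ}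
    (hderiv : ∀ x ∈ Ioi a, HasDerivAt p (p' x) x) (hp' : ContinuousOn p' (Ioi a)) {x : ℝ}
    (hx : a < x) :
    ENNReal.ofReal (p x) ≤ (∫⁻ t in Ioc a (a + 1), ENNReal.ofReal (p t)) +
      ∫⁻ t in Ioi a, ENNReal.ofReal |p' t| := by
  calc ENNReal.ofReal (p x) = ∫⁻ _ in Ioc a (a + 1), ENNReal.ofReal (p x) := by simp
    _ ≤ ∫⁻ y in Ioc a (a + 1),
          (ENNReal.ofReal (p y) + ∫⁻ t in Ioi a, ENNReal.ofReal |p' t|) := by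
        refine setLIntegral_mono' measurableSet_Ioc fun y hy => ?_
        calc ENNReal.ofReal (p x) = ENNReal.ofReal (p y + (p x - p y)) := by ring_nf
          _ ≤ ENNReal.ofReal (p y) + ENNReal.ofReal (p x - p y) := ENNReal.ofReal_add_le
          _ ≤ _ := by gcongr; exact ofReal_sub_le_lintegral_abs_deriv hderiv hp' hx hy.1
    _ = _ := by rw [lintegral_add_right _ measurable_const]; simp

theorem mul_le_rpow_add_rpow {p q ε : ℝ} (hpq : p.HolderConjugate q) (hε : 0 < ε) :
    ∃ C : ℝ, 0 ≤ C ∧ ∀ x y : ℝ, 0 ≤ x → 0 ≤ y → x * y ≤ ε * x ^ p + C * y ^ q := by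
  have hp := hpq.pos
  have hq := hpq.symm.pos
  refine ⟨(ε ^ (-p⁻¹)) ^ q / q, by positivity, fun x y hx hy => ?_⟩
  have hcancel : ε ^ p⁻¹ * ε ^ (-p⁻¹) = 1 := by
    rw [← Real.rpow_add hε, add_neg_cancel, Real.rpow_zero]
  calc x * y = (ε ^ p⁻¹ * x) * (ε ^ (-p⁻¹) * y) := by linear_combination -(x * y) * hcancel
    _ ≤ (ε ^ p⁻¹ * x) ^ p / p + (ε ^ (-p⁻¹) * y) ^ q / q :=
        Real.young_inequality_of_nonneg (by positivity) (by positivity) hpq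
    _ = ε * x ^ p / p + (ε ^ (-p⁻¹)) ^ q / q * y ^ q := by
        rw [Real.mul_rpow (by positivity) hx, Real.mul_rpow (by positivity) hy,
          Real.rpow_inv_rpow hε.le hp.ne']
        ring
    _ ≤ _ := by
        gcongr
        exact div_le_self (by positivity) hpq.lt.le

/-- Membership of `u^{1/β}` in the weighted Sobolev spaces of exponent `β = α / (α - 1)`, expressed
without dividing by `u`: for `u = w^β` the last condition says that `β |w'| ≤ d`. -/
structure RootGradientBound (α : ℝ) (u u' d : ℝ → ℝ) : Prop where
  hasDerivAt : ∀ x, HasDerivAt u (u' x) x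
  continuous_deriv : Continuous u'
  nonneg : ∀ x, 0 ≤ u x
  bound_nonneg : ∀ x, 0 ≤ d x
  abs_deriv_le : ∀ x, |u' x| ≤ u x ^ α⁻¹ * d x

/-- The `β`-th power of the weighted Sobolev norm of `u^{1/β}`, where `d` bounds its gradient in the
sense of `RootGradientBound`. -/
noncomputable def rootEnergy (α : ℝ) (μ : Measure ℝ) (u d : ℝ → ℝ) : ℝ≥0∞ :=
  ∫⁻ x, ENNReal.ofReal (u x + d x ^ α.conjExponent) ∂μ

namespace RootGradientBound

variable {α : ℝ} {u u' d : ℝ → ℝ}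

theorem continuous (hu : RootGradientBound α u u' d) : Continuous u :=
  continuous_iff_continuousAt.2 fun x => (hu.hasDerivAt x).continuousAt

theorem exists_mul_abs_deriv_le (hα : 1 < α) {ε : ℝ} (hε : 0 < ε) :
    ∃ C : ℝ, 0 ≤ C ∧ ∀ u u' d : ℝ → ℝ, RootGradientBound α u u' d → ∀ t x : ℝ, 0 ≤ t →
      t * |u' x| ≤ ε * (t ^ α * u x) + C * d x ^ α.conjExponent := by
  obtain ⟨C, hC, young⟩ :=
    mul_le_rpow_add_rpow (Real.HolderConjugate.conjExponent hα) hε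
  refine ⟨C, hC, fun u u' d hu t x ht => ?_⟩
  have hx := hu.nonneg x
  calc t * |u' x| ≤ t * (u x ^ α⁻¹ * d x) := by gcongr; exact hu.abs_deriv_le x
    _ = (t * u x ^ α⁻¹) * d x := by ring
    _ ≤ ε * (t * u x ^ α⁻¹) ^ α + C * d x ^ α.conjExponent :=
        young _ _ (by positivity) (hu.bound_nonneg x)
    _ = _ := by
        rw [Real.mul_rpow ht (by positivity), Real.rpow_inv_rpow hx (by linarith)]

theorem exists_lintegral_abs_deriv_le (hα : 1 < α) :
    ∃ C : ℝ, 0 ≤ C ∧ ∀ (μ : Measure ℝ) (u u' d : ℝ → ℝ), RootGradientBound α u u' d →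
      ∫⁻ x, ENNReal.ofReal |u' x| ∂μ ≤ ENNReal.ofReal C * rootEnergy α μ u d := by
  obtain ⟨C, hC, young⟩ := exists_mul_abs_deriv_le hα one_pos
  refine ⟨1 + C, by positivity, fun μ u u' d hu => ?_⟩
  rw [rootEnergy, ← lintegral_const_mul' _ _ ENNReal.ofReal_ne_top]
  refine lintegral_mono fun x => ?_
  rw [← ENNReal.ofReal_mul (by positivity)]
  refine ENNReal.ofReal_le_ofReal ?_
  have hyoung : |u' x| ≤ u x + C * d x ^ α.conjExponent := by
    simpa using young u u' d hu 1 x zero_le_one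
  have hd : 0 ≤ d x ^ α.conjExponent := Real.rpow_nonneg (hu.bound_nonneg x) _
  nlinarith [hu.nonneg x]

theorem lintegral_le_rootEnergy (hu : RootGradientBound α u u' d) (μ : Measure ℝ) :
    ∫⁻ x, ENNReal.ofReal (u x) ∂μ ≤ rootEnergy α μ u d :=
  lintegral_mono fun x => ENNReal.ofReal_le_ofReal <|
    le_add_of_nonneg_right (Real.rpow_nonneg (hu.bound_nonneg x) _)

end RootGradientBound

/-- The bound on the gradient of `|f|^{2/β}` which makes `f²` satisfy `RootGradientBound`; it
vanishes where `f` does. -/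
noncomputable def rootGradient (β : ℝ) (f f' : ℝ → ℝ) (x : ℝ) : ℝ :=
  2 * |f x| ^ (2 / β) * |f' x / f x|

theorem rootGradient_nonneg (β : ℝ) (f f' : ℝ → ℝ) (x : ℝ) : 0 ≤ rootGradient β f f' x := by
  unfold rootGradient
  positivity

theorem rootGradient_rpow {β : ℝ} (hβ : β ≠ 0) (f f' : ℝ → ℝ) (x : ℝ) :
    rootGradient β f f' x ^ β = 2 ^ β * (|f' x / f x| ^ β * f x ^ 2) := by
  have hroot : (|f x| ^ (2 / β)) ^ β = f x ^ 2 := by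
    rw [← Real.rpow_mul (abs_nonneg _), div_mul_cancel₀ _ hβ, Real.rpow_two, sq_abs]
  rw [rootGradient, Real.mul_rpow (by positivity) (abs_nonneg _),
    Real.mul_rpow zero_le_two (by positivity), hroot]
  ring

theorem rootGradientBound_sq {α : ℝ} (hα : 1 < α) {f f' : ℝ → ℝ}
    (hf : ∀ x, HasDerivAt f (f' x) x) (hf' : Continuous f') :
    RootGradientBound α (fun x => f x ^ 2) (fun x => 2 * f x * f' x)
      (rootGradient α.conjExponent f f') where
  hasDerivAt x := by simpa using (hf x).fun_pow 2
  continuous_deriv :=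
    (continuous_const.mul (continuous_iff_continuousAt.2 fun x => (hf x).continuousAt)).mul hf'
  nonneg x := sq_nonneg _
  bound_nonneg := rootGradient_nonneg _ f f'
  abs_deriv_le x := by
    have hc := Real.HolderConjugate.conjExponent hα
    rcases eq_or_ne (f x) 0 with h0 | h0
    · simp [h0, rootGradient]
    have hpos : 0 < |f x| := abs_pos.2 h0
    have hsplit : (f x ^ 2) ^ α⁻¹ * |f x| ^ (2 / α.conjExponent) = |f x| * |f x| := by
      rw [← sq_abs, ← Real.rpow_two, ← Real.rpow_mul hpos.le, ← Real.rpow_add hpos,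
        div_eq_mul_inv, ← mul_add, hc.inv_add_inv_eq_one, mul_one, Real.rpow_two, sq]
    refine le_of_eq ?_
    calc |2 * f x * f' x| = 2 * (|f x| * |f x|) * (|f' x| / |f x|) := by
          rw [abs_mul, abs_mul, abs_two]
          field_simp
      _ = _ := by rw [← hsplit, rootGradient, abs_div]; ring

/-- The truncation `w^β ↦ ((w - 1)₊)^β`. -/
noncomputable def rootTrunc (β y : ℝ) : ℝ :=
  (max 1 y ^ β⁻¹ - 1) ^ β

/-- The derivative of `rootTrunc β`. -/
noncomputable def rootTruncDeriv (β y : ℝ) : ℝ :=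
  (max 1 y ^ β⁻¹ - 1) ^ (β - 1) * max 1 y ^ (β⁻¹ - 1)

theorem one_le_max_one_rpow_inv {β : ℝ} (hβ : 0 ≤ β) (y : ℝ) : 1 ≤ max 1 y ^ β⁻¹ :=
  Real.one_le_rpow (le_max_left _ _) (inv_nonneg.2 hβ)

theorem rootTrunc_nonneg {β : ℝ} (hβ : 0 ≤ β) (y : ℝ) : 0 ≤ rootTrunc β y :=
  Real.rpow_nonneg (sub_nonneg.2 (one_le_max_one_rpow_inv hβ y)) _

theorem rootTrunc_of_le_one {β y : ℝ} (hβ : β ≠ 0) (hy : y ≤ 1) : rootTrunc β y = 0 := by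
  simp [rootTrunc, max_eq_left hy, Real.zero_rpow hβ]

theorem continuous_max_one_rpow (r : ℝ) : Continuous fun y : ℝ => max 1 y ^ r :=
  (continuous_const.max continuous_id).rpow_const fun y =>
    Or.inl (zero_lt_one.trans_le (le_max_left 1 y)).ne'

theorem continuous_rootTrunc {β : ℝ} (hβ : 0 ≤ β) : Continuous (rootTrunc β) :=
  ((continuous_max_one_rpow _).sub continuous_const).rpow_const fun _ => Or.inr hβ

theorem continuous_rootTruncDeriv {β : ℝ} (hβ : 1 ≤ β) : Continuous (rootTruncDeriv β) :=
  (((continuous_max_one_rpow _).sub continuous_const).rpow_const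
    fun _ => Or.inr (sub_nonneg.2 hβ)).mul (continuous_max_one_rpow _)

theorem hasDerivAt_rootTrunc {β : ℝ} (hβ : 1 < β) (y : ℝ) :
    HasDerivAt (rootTrunc β) (rootTruncDeriv β y) y := by
  have hβ0 : 0 < β := by linarith
  have off_one : ∀ z, z ≠ 1 → HasDerivAt (rootTrunc β) (rootTruncDeriv β z) z := by
    intro z hz
    rcases hz.lt_or_gt with hz | hz
    · have hlocal : rootTrunc β =ᶠ[nhds z] fun _ => 0 :=
        (eventually_lt_nhds hz).mono fun t ht => rootTrunc_of_le_one hβ0.ne' ht.le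
      have hzero : rootTruncDeriv β z = 0 := by
        simp [rootTruncDeriv, max_eq_left hz.le, Real.zero_rpow (sub_pos.2 hβ).ne']
      rw [hzero]
      exact (hasDerivAt_const z 0).congr_of_eventuallyEq hlocal
    · have hlocal : rootTrunc β =ᶠ[nhds z] fun t => (t ^ β⁻¹ - 1) ^ β :=
        (eventually_gt_nhds hz).mono fun t ht => by simp [rootTrunc, max_eq_right (le_of_lt ht)]
      have hroot : HasDerivAt (fun t : ℝ => t ^ β⁻¹ - 1) (β⁻¹ * z ^ (β⁻¹ - 1)) z :=
        (Real.hasDerivAt_rpow_const (Or.inl (by linarith))).sub_const 1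
      refine ((hroot.rpow_const (Or.inr hβ.le)).congr_of_eventuallyEq hlocal).congr_deriv ?_
      rw [rootTruncDeriv, max_eq_right hz.le]
      field_simp
  rcases eq_or_ne y 1 with rfl | hy
  · exact hasDerivAt_of_hasDerivAt_of_ne off_one (continuous_rootTrunc hβ0.le).continuousAt
      (continuous_rootTruncDeriv hβ.le).continuousAt
  · exact off_one y hy

theorem RootGradientBound.rootTrunc_comp {α : ℝ} (hα : 1 < α) {u u' d : ℝ → ℝ}
    (hu : RootGradientBound α u u' d) :
    RootGradientBound α (fun x => rootTrunc α.conjExponent (u x))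
      (fun x => rootTruncDeriv α.conjExponent (u x) * u' x) d := by
  have hc := Real.HolderConjugate.conjExponent hα
  set β := α.conjExponent
  have hβ : 1 < β := hc.symm.lt
  refine ⟨fun x => (hasDerivAt_rootTrunc hβ (u x)).comp x (hu.hasDerivAt x),
    ((continuous_rootTruncDeriv hβ.le).comp hu.continuous).mul hu.continuous_deriv,
    fun x => rootTrunc_nonneg (by linarith) _, hu.bound_nonneg, fun x => ?_⟩
  set m := max 1 (u x) with hm
  have hm0 : 0 < m := zero_lt_one.trans_le (le_max_left 1 (u x))
  have hd := hu.bound_nonneg x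
  have hbase : 0 ≤ m ^ β⁻¹ - 1 := sub_nonneg.2 (one_le_max_one_rpow_inv (by linarith) _)
  have hexp : β * α⁻¹ = β - 1 := hc.symm.div_conj_eq_sub_one
  have hcancel : m ^ (β⁻¹ - 1) * u x ^ α⁻¹ ≤ 1 := by
    calc m ^ (β⁻¹ - 1) * u x ^ α⁻¹ ≤ m ^ (β⁻¹ - 1) * m ^ α⁻¹ := by
          gcongr
          exacts [hu.nonneg x, le_max_right _ _]
      _ = 1 := by
          rw [← Real.rpow_add hm0, hc.symm.inv_sub_one, neg_add_cancel, Real.rpow_zero]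
  calc |rootTruncDeriv β (u x) * u' x|
      = (m ^ β⁻¹ - 1) ^ (β - 1) * m ^ (β⁻¹ - 1) * |u' x| := by
        rw [abs_mul, rootTruncDeriv, ← hm, abs_of_nonneg (by positivity)]
    _ ≤ (m ^ β⁻¹ - 1) ^ (β - 1) * m ^ (β⁻¹ - 1) * (u x ^ α⁻¹ * d x) := by
        gcongr
        exact hu.abs_deriv_le x
    _ = (m ^ β⁻¹ - 1) ^ (β - 1) * (m ^ (β⁻¹ - 1) * u x ^ α⁻¹) * d x := by ring
    _ ≤ (m ^ β⁻¹ - 1) ^ (β - 1) * 1 * d x := by gcongr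
    _ = rootTrunc β (u x) ^ α⁻¹ * d x := by
        rw [rootTrunc, ← hm, ← Real.rpow_mul hbase, hexp, mul_one]

theorem rootTrunc_sq_le {β : ℝ} (hβ : 2 ≤ β) (s : ℝ) : rootTrunc β (s ^ 2) ≤ (s - 1) ^ 2 := by
  rcases le_total (s ^ 2) 1 with hs | hs
  · rw [rootTrunc_of_le_one (by linarith) hs]
    positivity
  have habs : 1 ≤ |s| := (one_le_sq_iff_one_le_abs s).1 hs
  have hroot : (s ^ 2) ^ β⁻¹ = |s| ^ (2 / β) := by
    rw [← sq_abs, ← Real.rpow_two, ← Real.rpow_mul (abs_nonneg s), div_eq_mul_inv]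
  have hsubadd : |s| ^ (2 / β) ≤ (|s| - 1) ^ (2 / β) + 1 := by
    simpa using Real.rpow_add_le_add_rpow (sub_nonneg.2 habs) zero_le_one
      (div_nonneg zero_le_two (by linarith)) ((div_le_one (by linarith)).2 hβ)
  calc rootTrunc β (s ^ 2) = (|s| ^ (2 / β) - 1) ^ β := by
        rw [rootTrunc, max_eq_right hs, hroot]
    _ ≤ ((|s| - 1) ^ (2 / β)) ^ β := by
        gcongr
        · exact sub_nonneg.2 (Real.one_le_rpow habs (by positivity))
        · linarith
    _ = (|s| - 1) ^ 2 := by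
        rw [← Real.rpow_mul (sub_nonneg.2 habs), div_mul_cancel₀ _ (by linarith), Real.rpow_two]
    _ ≤ (s - 1) ^ 2 := by nlinarith [le_abs_self s, sq_abs s]

theorem le_two_rpow_mul_rootTrunc {β y : ℝ} (hβ : 0 < β) (hy : 2 ^ β ≤ y) :
    y ≤ 2 ^ β * rootTrunc β y := by
  have hy0 : 0 ≤ y := (by positivity : (0 : ℝ) ≤ 2 ^ β).trans hy
  have hy1 : 1 ≤ y := (Real.one_le_rpow one_le_two hβ.le).trans hy
  have hroot : 2 ≤ y ^ β⁻¹ := (Real.le_rpow_inv_iff_of_pos zero_le_two hy0 hβ).2 hy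
  calc y = (y ^ β⁻¹) ^ β := (Real.rpow_inv_rpow hy0 hβ.ne').symm
    _ ≤ (2 * (y ^ β⁻¹ - 1)) ^ β := by gcongr; linarith
    _ = 2 ^ β * rootTrunc β y := by
        rw [Real.mul_rpow zero_le_two (by linarith), rootTrunc, max_eq_right hy1]

theorem sq_mul_log_sub_add_one_le {β : ℝ} (hβ : 0 < β) {s L : ℝ} (hL0 : 0 ≤ L)
    (hL : Real.log (s ^ 2) ≤ L) :
    s ^ 2 * Real.log (s ^ 2) - s ^ 2 + 1 ≤
      2 * (2 ^ β + 1) * (s - 1) ^ 2 + 2 ^ β * (rootTrunc β (s ^ 2) * L) := by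
  have hK : (1 : ℝ) ≤ 2 ^ β := Real.one_le_rpow one_le_two hβ.le
  have htrunc := rootTrunc_nonneg hβ.le (s ^ 2)
  rcases le_total (2 ^ β) (s ^ 2) with hs | hs
  · have hlog : s ^ 2 * Real.log (s ^ 2) ≤ 2 ^ β * rootTrunc β (s ^ 2) * L :=
      mul_le_mul (le_two_rpow_mul_rootTrunc hβ hs) hL
        (Real.log_nonneg (hK.trans hs)) (by positivity)
    nlinarith [sq_nonneg (s - 1)]
  · have hquad : s ^ 2 * Real.log (s ^ 2) - s ^ 2 + 1 ≤ (s ^ 2 - 1) ^ 2 := by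
      rcases eq_or_ne s 0 with rfl | h0
      · norm_num
      nlinarith [Real.log_le_sub_one_of_pos (by positivity : 0 < s ^ 2), sq_nonneg s]
    calc s ^ 2 * Real.log (s ^ 2) - s ^ 2 + 1 ≤ (s + 1) ^ 2 * (s - 1) ^ 2 := by linarith
      _ ≤ 2 * (2 ^ β + 1) * (s - 1) ^ 2 := by
          gcongr
          nlinarith [sq_nonneg (s - 1)]
      _ ≤ _ := le_add_of_nonneg_right (by positivity)

section Muckenhoupt

variable {a M : ℝ} {w : ℝ → ℝ}

theorem hasDerivAt_integral_Ioi (hw : ContinuousOn w (Ioi a)) (hint : IntegrableOn w (Ioi a))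
    {x : ℝ} (hx : a < x) : HasDerivAt (fun t => ∫ y in Ioi t, w y) (-w x) x := by
  have hmem : Ioi a ∈ nhds x := Ioi_mem_nhds hx
  have hprim : HasDerivAt (fun t => ∫ y in a..t, w y) (w x) x :=
    intervalIntegral.integral_hasDerivAt_right
      ((intervalIntegrable_iff_integrableOn_Ioc_of_le hx.le).2 (hint.mono_set Ioc_subset_Ioi_self))
      (hw.stronglyMeasurableAtFilter isOpen_Ioi x hx) (hw.continuousAt hmem)
  refine (hprim.const_sub (∫ y in Ioi a, w y)).congr_of_eventuallyEq ?_
  filter_upwards [hmem] with t ht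
  rw [← intervalIntegral.integral_Ioi_sub_Ioi hint (le_of_lt ht), sub_sub_cancel]

theorem continuousOn_integral_Ioi (hint : IntegrableOn w (Ioi a)) :
    ContinuousOn (fun t => ∫ y in Ioi t, w y) (Ici a) := by
  have hind : Integrable ((Ioi a).indicator w) := hint.integrable_indicator measurableSet_Ioi
  refine (continuous_const.sub (intervalIntegral.continuous_primitive
    (fun _ _ => hind.intervalIntegrable) a)).continuousOn.congr (f := fun t =>
      (∫ y in Ioi a, w y) - ∫ y in a..t, (Ioi a).indicator w y) fun t ht => ?_
  beta_reduce
  rw [intervalIntegral.integral_of_le ht, setIntegral_congr_fun measurableSet_Ioc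
    fun y hy => indicator_of_mem (Ioc_subset_Ioi_self hy) w, ← intervalIntegral.integral_of_le ht,
    ← intervalIntegral.integral_Ioi_sub_Ioi hint ht, sub_sub_cancel]

theorem integrableOn_Ioi_of_lintegral_le (hw : ContinuousOn w (Ioi a))
    (hw0 : ∀ x ∈ Ioi a, 0 ≤ w x) {b : ℝ}
    (hle : ∫⁻ y in Ioi a, ENNReal.ofReal (w y) ≤ ENNReal.ofReal b) : IntegrableOn w (Ioi a) :=
  ⟨hw.aestronglyMeasurable measurableSet_Ioi,
    (hasFiniteIntegral_iff_ofReal (ae_restrict_of_forall_mem measurableSet_Ioi hw0)).2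
      (hle.trans_lt ENNReal.ofReal_lt_top)⟩

theorem mul_mul_le_of_le_mul {T v : ℝ} (hT0 : 0 ≤ T) (hT : T ≤ M * v) (hv : 0 ≤ v) (g h : ℝ) :
    4 * (T * (g * h)) ≤ v * (g ^ 2 + 4 * M ^ 2 * h ^ 2) := by
  calc 4 * (T * (g * h)) ≤ 4 * (T * |g * h|) := by gcongr; exact le_abs_self _
    _ ≤ 4 * (M * v * |g * h|) := by gcongr
    _ = v * (2 * |g| * (2 * M * |h|)) := by rw [abs_mul]; ring
    _ ≤ v * (|g| ^ 2 + (2 * M * |h|) ^ 2) := by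
        gcongr
        exact two_mul_le_add_sq _ _
    _ = _ := by rw [mul_pow, mul_pow, sq_abs, sq_abs]; ring

/- Muckenhoupt's argument: differentiating `T g²`, where `T` is the tail of `w`, replaces `w g²` by
`T g g'`, which the tail bound `T ≤ M w` and AM-GM absorb. -/
theorem lintegral_mul_sub_sq_le_of_tail_le (hw : ContinuousOn w (Ici a)) (hw0 : ∀ x ≥ a, 0 ≤ w x)
    (hM : 0 ≤ M)
    (htail : ∀ x ≥ a, ∫⁻ y in Ioi x, ENNReal.ofReal (w y) ≤ ENNReal.ofReal (M * w x))
    {k k' : ℝ → ℝ} (hk : ∀ x, HasDerivAt k (k' x) x) (hk' : Continuous k') :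
    ∫⁻ x in Ioi a, ENNReal.ofReal (w x * (k x - k a) ^ 2) ≤
      ENNReal.ofReal (4 * M ^ 2) * ∫⁻ x in Ioi a, ENNReal.ofReal (w x * k' x ^ 2) := by
  have hwI : ContinuousOn w (Ioi a) := hw.mono Ioi_subset_Ici_self
  have hint : IntegrableOn w (Ioi a) :=
    integrableOn_Ioi_of_lintegral_le hwI (fun x hx => hw0 x (le_of_lt hx)) (htail a le_rfl)
  have hkc : Continuous k := continuous_iff_continuousAt.2 fun x => (hk x).continuousAt
  set T : ℝ → ℝ := fun x => ∫ y in Ioi x, w y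
  have hT0 : ∀ x ≥ a, 0 ≤ T x := fun x hx =>
    setIntegral_nonneg measurableSet_Ioi fun y hy => hw0 y (hx.trans (le_of_lt hy))
  have hT : ∀ x ≥ a, T x ≤ M * w x := fun x hx => by
    refine (ENNReal.ofReal_le_ofReal_iff (mul_nonneg hM (hw0 x hx))).1 ?_
    exact (ofReal_integral_le_lintegral (hint.mono_set (Ioi_subset_Ioi hx))).trans (htail x hx)
  have hTc : ContinuousOn T (Ici a) := continuousOn_integral_Ioi hint
  have key := lintegral_Ioi_le_of_deriv_add_le (b := 0)
    (p := fun x => 2 * (T x * (k x - k a) ^ 2))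
    (p' := fun x => 4 * (T x * ((k x - k a) * k' x)) - 2 * (w x * (k x - k a) ^ 2))
    (F := fun x => w x * (k x - k a) ^ 2) (G := fun x => 4 * M ^ 2 * (w x * k' x ^ 2))
    (by fun_prop) (fun x hx => ?_) (by fun_prop) (by fun_prop)
    (fun x hx => mul_nonneg (hw0 x (le_of_lt hx)) (sq_nonneg _)) (fun x hx => ?_)
    (fun x hx => ?_)
  · simpa only [ENNReal.ofReal_zero, add_zero, ENNReal.ofReal_mul (by positivity : 0 ≤ 4 * M ^ 2),
      lintegral_const_mul' _ _ ENNReal.ofReal_ne_top] using key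
  · refine (((hasDerivAt_integral_Ioi hwI hint hx).fun_mul
      (((hk x).sub_const (k a)).fun_pow 2)).const_mul 2).congr_deriv ?_
    push_cast
    ring
  · have hx : a ≤ x := le_of_lt hx
    have absorb := mul_mul_le_of_le_mul (hT0 x hx) (hT x hx) (hw0 x hx) (k x - k a) (k' x)
    linarith
  · rw [sub_self, zero_pow two_ne_zero, mul_zero, mul_zero, add_zero]
    exact mul_nonneg zero_le_two (mul_nonneg (hT0 x (le_of_lt hx)) (sq_nonneg _))

end Muckenhoupt

/-- The measure `exp (-V x) dx` on `]0, ∞[`. -/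
noncomputable def halfLineMeasure (V : ℝ → ℝ) : Measure ℝ :=
  (volume.restrict (Ioi (0 : ℝ))).withDensity fun x => ENNReal.ofReal (Real.exp (-V x))

theorem lintegral_halfLineMeasure {V : ℝ → ℝ} (hV : ContinuousOn V (Ioi 0)) (F : ℝ → ℝ) :
    ∫⁻ x, ENNReal.ofReal (F x) ∂halfLineMeasure V =
      ∫⁻ x in Ioi 0, ENNReal.ofReal (Real.exp (-V x) * F x) := by
  have hmeas : AEMeasurable (fun x => ENNReal.ofReal (Real.exp (-V x)))
      (volume.restrict (Ioi 0)) := (hV.neg.rexp.aemeasurable measurableSet_Ioi).ennreal_ofReal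
  rw [halfLineMeasure, lintegral_withDensity_eq_lintegral_mul_non_measurable₀ _ hmeas
    (ae_of_all _ fun x => ENNReal.ofReal_lt_top)]
  refine lintegral_congr fun x => ?_
  rw [Pi.mul_apply, ENNReal.ofReal_mul (Real.exp_pos _).le]

/-- Potentials on `[0, ∞[` that grow like `x ^ α` together with their derivative. The latter, which
may be singular at `0`, is given as `q x / x`. -/
structure HalfLinePotential (α : ℝ) (V q : ℝ → ℝ) : Prop where
  continuousOn : ContinuousOn V (Ici 0)
  continuousOn_deriv : ContinuousOn q (Ici 0)
  hasDerivAt : ∀ x, 0 < x → HasDerivAt V (q x / x) x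
  exists_sub_le : ∃ c B : ℝ, 0 < c ∧ 0 ≤ B ∧ ∀ x, 0 < x → c * (1 + x) ^ α - B ≤ q x
  exists_le : ∃ K : ℝ, 0 ≤ K ∧ ∀ x, 0 < x → V x ≤ K * (1 + x) ^ α

namespace HalfLinePotential

variable {α : ℝ} {V q : ℝ → ℝ}

theorem lintegral_eq (h : HalfLinePotential α V q) (F : ℝ → ℝ) :
    ∫⁻ x, ENNReal.ofReal (F x) ∂halfLineMeasure V =
      ∫⁻ x in Ioi 0, ENNReal.ofReal (Real.exp (-V x) * F x) :=
  lintegral_halfLineMeasure (h.continuousOn.mono Ioi_subset_Ici_self) F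

theorem add_const (h : HalfLinePotential α V q) (hα : 0 ≤ α) (r : ℝ) :
    HalfLinePotential α (fun x => V x + r) q where
  continuousOn := h.continuousOn.add continuousOn_const
  continuousOn_deriv := h.continuousOn_deriv
  hasDerivAt x hx := (h.hasDerivAt x hx).add_const r
  exists_sub_le := h.exists_sub_le
  exists_le := by
    obtain ⟨K, hK, hle⟩ := h.exists_le
    refine ⟨K + |r|, by positivity, fun x hx => ?_⟩
    have hone : 1 ≤ (1 + x) ^ α := Real.one_le_rpow (by linarith) hα
    calc V x + r ≤ K * (1 + x) ^ α + |r| * 1 := by linarith [hle x hx, le_abs_self r]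
      _ ≤ K * (1 + x) ^ α + |r| * (1 + x) ^ α := by gcongr
      _ = (K + |r|) * (1 + x) ^ α := by ring

theorem exists_tail_le_of_ge (h : HalfLinePotential α V q) (hα : 1 ≤ α) :
    ∃ L > 0, ∃ M ≥ 0, ∀ x ≥ L, ∫⁻ y in Ioi x, ENNReal.ofReal (Real.exp (-V y)) ≤
      ENNReal.ofReal (M * Real.exp (-V x)) := by
  obtain ⟨c, B, hc, -, hq⟩ := h.exists_sub_le
  refine ⟨max 1 (2 * B / c), by positivity, 2 / c, by positivity, fun x hx => ?_⟩
  have hx0 : 0 < x := zero_lt_one.trans_le ((le_max_left _ _).trans hx)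
  have hsub : Ici x ⊆ Ici 0 := Ici_subset_Ici.2 hx0.le
  have cV := h.continuousOn.mono hsub
  have cq := h.continuousOn_deriv.mono hsub
  have hne : ∀ y ∈ Ici x, y ≠ 0 := fun y hy => (hx0.trans_le hy).ne'
  have key := lintegral_Ioi_le_of_deriv_add_le (a := x) (b := 2 / c * Real.exp (-V x))
    (p := fun y => 2 / c * Real.exp (-V y))
    (p' := fun y => 2 / c * (Real.exp (-V y) * -(q y / y)))
    (F := fun y => Real.exp (-V y)) (G := fun _ => 0)
    (by fun_prop) (fun y hy => ((h.hasDerivAt y (hx0.trans hy)).fun_neg.exp).const_mul _)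
    (by fun_prop (disch := assumption)) (by fun_prop) (fun y _ => (Real.exp_pos _).le)
    (fun y hy => ?_) (fun y _ => le_add_of_nonneg_left (by positivity))
  · simpa using key
  · have hxy : x < y := hy
    have hy0 : 0 < y := hx0.trans hxy
    have hBy : 2 * B ≤ y * c :=
      (div_le_iff₀ hc).1 ((le_max_right _ _).trans (hx.trans hxy.le))
    have hgrowth : 1 + y ≤ (1 + y) ^ α := Real.self_le_rpow_of_one_le (by linarith) hα
    have hslope : c / 2 ≤ q y / y := by
      rw [le_div_iff₀ hy0]
      nlinarith [hq y hy0]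
    have : 1 ≤ 2 / c * (q y / y) := by
      calc (1 : ℝ) = 2 / c * (c / 2) := by field_simp
        _ ≤ _ := by gcongr
    nlinarith [Real.exp_pos (-V y)]

theorem exists_tail_le (h : HalfLinePotential α V q) (hα : 1 ≤ α) :
    ∃ M ≥ 0, ∀ x ≥ 0, ∫⁻ y in Ioi x, ENNReal.ofReal (Real.exp (-V y)) ≤
      ENNReal.ofReal (M * Real.exp (-V x)) := by
  obtain ⟨L, hL, M, hM, htail⟩ := h.exists_tail_le_of_ge hα
  obtain ⟨D, hD⟩ := isCompact_Icc.exists_bound_of_continuousOn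
    (h.continuousOn.mono (Icc_subset_Ici_self : Icc 0 L ⊆ Ici 0))
  have hV : ∀ y ∈ Icc 0 L, |V y| ≤ D := hD
  refine ⟨(L + M) * Real.exp (2 * D) + M, by positivity, fun x hx => ?_⟩
  rcases le_total L x with hLx | hxL
  · refine (htail x hLx).trans (ENNReal.ofReal_le_ofReal ?_)
    gcongr
    exact le_add_of_nonneg_left (by positivity)
  have hlocal : ∫⁻ y in Ioc x L, ENNReal.ofReal (Real.exp (-V y)) ≤
      ENNReal.ofReal (L * Real.exp D) := by
    calc ∫⁻ y in Ioc x L, ENNReal.ofReal (Real.exp (-V y))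
        ≤ ∫⁻ _ in Ioc x L, ENNReal.ofReal (Real.exp D) :=
          setLIntegral_mono' measurableSet_Ioc fun y hy => ENNReal.ofReal_le_ofReal <|
            Real.exp_le_exp.2 <| (neg_le_abs _).trans (hV y ⟨hx.trans hy.1.le, hy.2⟩)
      _ = ENNReal.ofReal (Real.exp D * (L - x)) := by
          rw [setLIntegral_const, Real.volume_Ioc, ENNReal.ofReal_mul (Real.exp_pos _).le]
      _ ≤ _ := ENNReal.ofReal_le_ofReal (by nlinarith [Real.exp_pos D])
  have hfar : ∫⁻ y in Ioi L, ENNReal.ofReal (Real.exp (-V y)) ≤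
      ENNReal.ofReal (M * Real.exp D) := by
    refine (htail L le_rfl).trans (ENNReal.ofReal_le_ofReal ?_)
    gcongr
    exact (neg_le_abs _).trans (hV L ⟨hL.le, le_rfl⟩)
  have hexp : Real.exp D ≤ Real.exp (2 * D) * Real.exp (-V x) := by
    rw [← Real.exp_add, Real.exp_le_exp]
    linarith [(le_abs_self _).trans (hV x ⟨hx, hxL⟩)]
  calc ∫⁻ y in Ioi x, ENNReal.ofReal (Real.exp (-V y))
      ≤ ENNReal.ofReal (L * Real.exp D) + ENNReal.ofReal (M * Real.exp D) := by
        rw [← Ioc_union_Ioi_eq_Ioi hxL]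
        exact (lintegral_union_le _ _ _).trans (add_le_add hlocal hfar)
    _ = ENNReal.ofReal ((L + M) * Real.exp D) := by
        rw [← ENNReal.ofReal_add (by positivity) (by positivity), add_mul]
    _ ≤ ENNReal.ofReal ((L + M) * (Real.exp (2 * D) * Real.exp (-V x)) +
          M * Real.exp (-V x)) := ENNReal.ofReal_le_ofReal <|
        le_add_of_le_of_nonneg (by gcongr) (by positivity)
    _ = _ := by ring_nf

theorem integrableOn_exp_neg (h : HalfLinePotential α V q) (hα : 1 ≤ α) :
    IntegrableOn (fun x => Real.exp (-V x)) (Ioi 0) := by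
  obtain ⟨M, -, htail⟩ := h.exists_tail_le hα
  exact integrableOn_Ioi_of_lintegral_le (h.continuousOn.mono Ioi_subset_Ici_self).neg.rexp
    (fun x _ => (Real.exp_pos _).le) (htail 0 le_rfl)

theorem exists_hardy (h : HalfLinePotential α V q) (hα : 1 ≤ α) :
    ∃ C : ℝ, 0 ≤ C ∧ ∀ k k' : ℝ → ℝ, (∀ x, HasDerivAt k (k' x) x) → Continuous k' →
      ∫⁻ x, ENNReal.ofReal ((k x - k 0) ^ 2) ∂halfLineMeasure V ≤
        ENNReal.ofReal C * ∫⁻ x, ENNReal.ofReal (k' x ^ 2) ∂halfLineMeasure V := by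
  obtain ⟨M, hM, htail⟩ := h.exists_tail_le hα
  refine ⟨4 * M ^ 2, by positivity, fun k k' hk hk' => ?_⟩
  rw [h.lintegral_eq, h.lintegral_eq]
  exact lintegral_mul_sub_sq_le_of_tail_le h.continuousOn.neg.rexp
    (fun x _ => (Real.exp_pos _).le) hM htail hk hk'

theorem exists_drift_le (h : HalfLinePotential α V q) (hα : 1 < α) :
    ∃ c > 0, ∃ A : ℝ, 0 ≤ A ∧ ∀ u u' d : ℝ → ℝ, RootGradientBound α u u' d → ∀ x > 0,
      u x + x * u' x - q x * u x + c * ((1 + x) ^ α * u x) ≤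
        A * (u x + d x ^ α.conjExponent) := by
  obtain ⟨c, B, hc, hB, hq⟩ := h.exists_sub_le
  obtain ⟨C, hC, young⟩ := RootGradientBound.exists_mul_abs_deriv_le hα (half_pos hc)
  refine ⟨c / 2, half_pos hc, 1 + B + C, by positivity, fun u u' d hu x hx => ?_⟩
  have hux := hu.nonneg x
  have hdx : 0 ≤ d x ^ α.conjExponent := Real.rpow_nonneg (hu.bound_nonneg x) _
  have hdrift : x * u' x ≤ c / 2 * ((1 + x) ^ α * u x) + C * d x ^ α.conjExponent :=
    calc x * u' x ≤ (1 + x) * |u' x| := by nlinarith [le_abs_self (u' x), abs_nonneg (u' x)]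
      _ ≤ _ := young u u' d hu _ x (by linarith)
  nlinarith [mul_le_mul_of_nonneg_right (hq x hx) hux]

theorem exists_moment (h : HalfLinePotential α V q) (hα : 1 < α) :
    ∃ C : ℝ, 0 ≤ C ∧ ∀ u u' d : ℝ → ℝ, RootGradientBound α u u' d →
      ∫⁻ x, ENNReal.ofReal ((1 + |x|) ^ α * u x) ∂halfLineMeasure V ≤
        ENNReal.ofReal C * rootEnergy α (halfLineMeasure V) u d := by
  obtain ⟨c, hc, A, hA, hdrift⟩ := h.exists_drift_le hα
  refine ⟨A / c, by positivity, fun u u' d hu => ?_⟩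
  have cu := hu.continuous
  have cu' := hu.continuous_deriv
  have cV := h.continuousOn
  have cq := h.continuousOn_deriv
  have cT : Continuous fun x : ℝ => (1 + |x|) ^ α :=
    (continuous_const.add continuous_abs).rpow_const fun x => Or.inr (by linarith)
  have key := lintegral_Ioi_le_of_deriv_add_le (a := 0) (b := 0)
    (p := fun x => x * u x * Real.exp (-V x) / c)
    (p' := fun x => Real.exp (-V x) * (u x + x * u' x - q x * u x) / c)
    (F := fun x => Real.exp (-V x) * ((1 + |x|) ^ α * u x))
    (G := fun x => A / c * (Real.exp (-V x) * (u x + d x ^ α.conjExponent)))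
    (by fun_prop) (fun x hx => ?_) (by fun_prop) (by fun_prop)
    (fun x _ => by have := hu.nonneg x; positivity) (fun x hx => ?_) (fun x hx => ?_)
  · rw [rootEnergy, h.lintegral_eq, h.lintegral_eq,
      ← lintegral_const_mul' _ _ ENNReal.ofReal_ne_top]
    simpa only [ENNReal.ofReal_zero, add_zero,
      ENNReal.ofReal_mul (by positivity : 0 ≤ A / c)] using key
  · have hx : 0 < x := hx
    refine ((((hasDerivAt_id' x).fun_mul (hu.hasDerivAt x)).fun_mul
      (h.hasDerivAt x hx).fun_neg.exp).div_const c).congr_deriv ?_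
    field_simp
    ring
  · have hx : 0 < x := hx
    rw [abs_of_pos hx]
    calc _ = Real.exp (-V x) / c *
          (u x + x * u' x - q x * u x + c * ((1 + x) ^ α * u x)) := by field_simp
      _ ≤ Real.exp (-V x) / c * (A * (u x + d x ^ α.conjExponent)) := by
          gcongr
          exact hdrift u u' d hu x hx
      _ = _ := by ring
  · have hx : 0 < x := hx
    have := hu.nonneg x
    simp only [zero_mul, zero_div, add_zero]
    positivity

end HalfLinePotential

/-- The three inequalities from which the logarithmic Sobolev inequality is deduced: a Hardy
inequality, a moment bound of order `α` and a weighted embedding into `L^∞`. A single constant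
serves for all three, so that sums of measures can be treated. -/
structure HardyMomentBounds (α : ℝ) (μ : Measure ℝ) (C : ℝ) : Prop where
  one_le : 1 ≤ C
  hardy : ∀ k k' : ℝ → ℝ, (∀ x, HasDerivAt k (k' x) x) → Continuous k' →
    ∫⁻ x, ENNReal.ofReal ((k x - k 0) ^ 2) ∂μ ≤
      ENNReal.ofReal C * ∫⁻ x, ENNReal.ofReal (k' x ^ 2) ∂μ
  moment : ∀ u u' d : ℝ → ℝ, RootGradientBound α u u' d →
    ∫⁻ x, ENNReal.ofReal ((1 + |x|) ^ α * u x) ∂μ ≤ ENNReal.ofReal C * rootEnergy α μ u d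
  pointwise : ∀ u u' d : ℝ → ℝ, RootGradientBound α u u' d → ∀ᵐ x ∂μ, ENNReal.ofReal (u x) ≤
    ENNReal.ofReal (C * Real.exp (C * (1 + |x|) ^ α)) * rootEnergy α μ u d

namespace HalfLinePotential

variable {α : ℝ} {V q : ℝ → ℝ}

theorem lintegral_damped_le (h : HalfLinePotential α V q) {K : ℝ}
    (hK : ∀ x, 0 < x → V x ≤ K * (1 + x) ^ α) {F : ℝ → ℝ} (hF : ∀ x, 0 ≤ F x) :
    ∫⁻ x in Ioi 0, ENNReal.ofReal (Real.exp (-(K * (1 + x) ^ α)) * F x) ≤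
      ∫⁻ x, ENNReal.ofReal (F x) ∂halfLineMeasure V := by
  rw [h.lintegral_eq]
  refine setLIntegral_mono' measurableSet_Ioi fun x hx => ENNReal.ofReal_le_ofReal ?_
  exact mul_le_mul_of_nonneg_right (Real.exp_le_exp.2 (neg_le_neg (hK x hx))) (hF x)

theorem lintegral_abs_damped_deriv_le (h : HalfLinePotential α V q) (hα : 0 < α) {K : ℝ}
    (hK0 : 0 ≤ K) (hK : ∀ x, 0 < x → V x ≤ K * (1 + x) ^ α) {u u' : ℝ → ℝ} (hu0 : ∀ x, 0 ≤ u x)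
    (hu' : Continuous u') :
    ∫⁻ x in Ioi 0, ENNReal.ofReal |Real.exp (-(K * (1 + x) ^ α)) *
        (u' x - K * (α * (1 + x) ^ (α - 1)) * u x)| ≤
      (∫⁻ x, ENNReal.ofReal |u' x| ∂halfLineMeasure V) +
        ENNReal.ofReal (K * α) * ∫⁻ x, ENNReal.ofReal ((1 + |x|) ^ α * u x) ∂halfLineMeasure V := by
  have hT0 : ∀ x : ℝ, 0 ≤ (1 + |x|) ^ α * u x := fun x => mul_nonneg (by positivity) (hu0 x)
  calc _ ≤ ∫⁻ x in Ioi 0, (ENNReal.ofReal (Real.exp (-(K * (1 + x) ^ α)) * |u' x|) +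
          ENNReal.ofReal (K * α) *
            ENNReal.ofReal (Real.exp (-(K * (1 + x) ^ α)) * ((1 + |x|) ^ α * u x))) := by
        refine setLIntegral_mono' measurableSet_Ioi fun x hx => ?_
        have hx : 0 < x := hx
        have hux := hu0 x
        have hpow : (1 + x) ^ (α - 1) ≤ (1 + |x|) ^ α := by
          rw [abs_of_pos hx]
          exact Real.rpow_le_rpow_of_exponent_le (by linarith) (by linarith)
        rw [← ENNReal.ofReal_mul (by positivity),
          ← ENNReal.ofReal_add (by positivity) (by positivity), abs_mul, Real.abs_exp]
        refine ENNReal.ofReal_le_ofReal ?_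
        calc _ ≤ Real.exp (-(K * (1 + x) ^ α)) *
              (|u' x| + K * (α * (1 + x) ^ (α - 1)) * u x) := by
              gcongr
              refine (abs_sub _ _).trans_eq ?_
              rw [abs_of_nonneg (by positivity : 0 ≤ K * (α * (1 + x) ^ (α - 1)) * u x)]
          _ ≤ Real.exp (-(K * (1 + x) ^ α)) * (|u' x| + K * (α * (1 + |x|) ^ α) * u x) := by
              gcongr
          _ = _ := by ring
    _ ≤ _ := by
        have hu'_meas := hu'.measurable
        have hmeas : Measurable fun x : ℝ =>
            ENNReal.ofReal (Real.exp (-(K * (1 + x) ^ α)) * |u' x|) := by fun_prop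
        rw [lintegral_add_left hmeas,
          lintegral_const_mul' _ _ ENNReal.ofReal_ne_top]
        exact add_le_add (h.lintegral_damped_le hK fun x => abs_nonneg (u' x))
          (mul_le_mul' le_rfl (h.lintegral_damped_le hK hT0))

theorem ofReal_damped_le (h : HalfLinePotential α V q) (hα : 0 < α) {K : ℝ} (hK0 : 0 ≤ K)
    (hK : ∀ x, 0 < x → V x ≤ K * (1 + x) ^ α) {u u' : ℝ → ℝ} (hu : ∀ x, HasDerivAt u (u' x) x)
    (hu' : Continuous u') (hu0 : ∀ x, 0 ≤ u x) {x : ℝ} (hx : 0 < x) :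
    ENNReal.ofReal (Real.exp (-(K * (1 + x) ^ α)) * u x) ≤
      (∫⁻ x, ENNReal.ofReal (u x) ∂halfLineMeasure V) +
        ((∫⁻ x, ENNReal.ofReal |u' x| ∂halfLineMeasure V) + ENNReal.ofReal (K * α) *
          ∫⁻ x, ENNReal.ofReal ((1 + |x|) ^ α * u x) ∂halfLineMeasure V) := by
  have cu : Continuous u := continuous_iff_continuousAt.2 fun x => (hu x).continuousAt
  have hbase : ∀ y ∈ Ioi (0 : ℝ), 1 + y ≠ 0 := fun y hy => by linarith [mem_Ioi.1 hy]
  have cpow : ∀ r : ℝ, ContinuousOn (fun y : ℝ => (1 + y) ^ r) (Ioi 0) := fun r =>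
    (continuousOn_const.add continuousOn_id).rpow_const fun y hy => Or.inl (hbase y hy)
  refine (ofReal_le_lintegral_add_lintegral_abs_deriv
    (p := fun y => Real.exp (-(K * (1 + y) ^ α)) * u y) (p' := fun y =>
      Real.exp (-(K * (1 + y) ^ α)) * (u' y - K * (α * (1 + y) ^ (α - 1)) * u y))
    (fun y hy => ?_) ?_ hx).trans (add_le_add ?_ ?_)
  · refine (((((hasDerivAt_id' y).const_add 1).rpow_const (p := α)
      (Or.inl (hbase y hy))).const_mul K).fun_neg.exp.fun_mul (hu y)).congr_deriv ?_
    ring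
  · exact ((cpow α).const_mul K).neg.rexp.mul
      (hu'.continuousOn.sub ((((cpow _).const_mul α).const_mul K).mul cu.continuousOn))
  · exact (lintegral_mono_set Ioc_subset_Ioi_self).trans (h.lintegral_damped_le hK hu0)
  · exact h.lintegral_abs_damped_deriv_le hα hK0 hK hu0 hu'

theorem exists_pointwise (h : HalfLinePotential α V q) (hα : 1 < α) :
    ∃ C : ℝ, 0 ≤ C ∧ ∀ u u' d : ℝ → ℝ, RootGradientBound α u u' d →
      ∀ x > 0, ENNReal.ofReal (u x) ≤ ENNReal.ofReal (C * Real.exp (C * (1 + |x|) ^ α)) *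
        rootEnergy α (halfLineMeasure V) u d := by
  obtain ⟨K, hK0, hK⟩ := h.exists_le
  obtain ⟨C₁, hC₁, hderiv⟩ := RootGradientBound.exists_lintegral_abs_deriv_le hα
  obtain ⟨C₂, hC₂, hmoment⟩ := h.exists_moment hα
  set A := 1 + C₁ + K * α * C₂ with hA
  have hA0 : 0 ≤ A := by positivity
  refine ⟨A + K, by positivity, fun u u' d hu x hx => ?_⟩
  set E := rootEnergy α (halfLineMeasure V) u d
  have hdamped : ENNReal.ofReal (Real.exp (-(K * (1 + x) ^ α)) * u x) ≤ ENNReal.ofReal A * E := by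
    calc _ ≤ E + (ENNReal.ofReal C₁ * E + ENNReal.ofReal (K * α) * (ENNReal.ofReal C₂ * E)) := by
          refine (h.ofReal_damped_le (by linarith) hK0 hK hu.hasDerivAt hu.continuous_deriv
            hu.nonneg hx).trans ?_
          gcongr
          exacts [hu.lintegral_le_rootEnergy _, hderiv _ u u' d hu, hmoment u u' d hu]
      _ = ENNReal.ofReal A * E := by
          rw [hA, ENNReal.ofReal_add (by positivity) (by positivity),
            ENNReal.ofReal_add zero_le_one hC₁,
            ENNReal.ofReal_mul (p := K * α) (q := C₂) (by positivity), ENNReal.ofReal_one]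
          ring
  calc ENNReal.ofReal (u x) = ENNReal.ofReal (Real.exp (K * (1 + x) ^ α)) *
        ENNReal.ofReal (Real.exp (-(K * (1 + x) ^ α)) * u x) := by
        rw [← ENNReal.ofReal_mul (Real.exp_pos _).le, ← mul_assoc, ← Real.exp_add,
          add_neg_cancel, Real.exp_zero, one_mul]
    _ ≤ ENNReal.ofReal (Real.exp (K * (1 + x) ^ α)) * (ENNReal.ofReal A * E) := by gcongr
    _ = ENNReal.ofReal (A * Real.exp (K * (1 + x) ^ α)) * E := by
        rw [ENNReal.ofReal_mul hA0]
        ring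
    _ ≤ _ := by
        rw [abs_of_pos hx]
        gcongr
        exacts [le_add_of_nonneg_right hK0, le_add_of_nonneg_left hA0]

theorem exists_hardyMomentBounds (h : HalfLinePotential α V q) (hα : 1 < α) :
    ∃ C, HardyMomentBounds α (halfLineMeasure V) C := by
  obtain ⟨C₁, hC₁, hardy⟩ := h.exists_hardy hα.le
  obtain ⟨C₂, hC₂, moment⟩ := h.exists_moment hα
  obtain ⟨C₃, hC₃, pointwise⟩ := h.exists_pointwise hα
  have h₁ : C₁ ≤ 1 + C₁ + C₂ + C₃ := by linarith
  have h₂ : C₂ ≤ 1 + C₁ + C₂ + C₃ := by linarith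
  have h₃ : C₃ ≤ 1 + C₁ + C₂ + C₃ := by linarith
  refine ⟨1 + C₁ + C₂ + C₃, by linarith, fun k k' hk hk' => ?_, fun u u' d hu => ?_,
    fun u u' d hu => ?_⟩
  · exact (hardy k k' hk hk').trans (by gcongr)
  · exact (moment u u' d hu).trans (by gcongr)
  · have hpos : ∀ᵐ x ∂halfLineMeasure V, x ∈ Ioi (0 : ℝ) :=
      (withDensity_absolutelyContinuous _ _).ae_le (ae_restrict_mem measurableSet_Ioi)
    filter_upwards [hpos] with x hx
    exact (pointwise u u' d hu x hx).trans (by gcongr)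

end HalfLinePotential

theorem RootGradientBound.comp_neg {α : ℝ} {u u' d : ℝ → ℝ} (hu : RootGradientBound α u u' d) :
    RootGradientBound α (fun x => u (-x)) (fun x => -u' (-x)) fun x => d (-x) where
  hasDerivAt x := by simpa [Function.comp_def] using (hu.hasDerivAt (-x)).comp x (hasDerivAt_neg x)
  continuous_deriv := (hu.continuous_deriv.comp continuous_neg).neg
  nonneg x := hu.nonneg _
  bound_nonneg x := hu.bound_nonneg _
  abs_deriv_le x := by simpa using hu.abs_deriv_le (-x)

namespace HardyMomentBounds

variable {α C : ℝ} {μ ν : Measure ℝ}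

theorem add (hμ : HardyMomentBounds α μ C) (hν : HardyMomentBounds α ν C) :
    HardyMomentBounds α (μ + ν) C where
  one_le := hμ.one_le
  hardy k k' hk hk' := by
    simp only [lintegral_add_measure, mul_add]
    exact add_le_add (hμ.hardy k k' hk hk') (hν.hardy k k' hk hk')
  moment u u' d hu := by
    simp only [rootEnergy, lintegral_add_measure, mul_add]
    exact add_le_add (hμ.moment u u' d hu) (hν.moment u u' d hu)
  pointwise u u' d hu := by
    simp only [rootEnergy, lintegral_add_measure, mul_add]
    exact ae_add_measure_iff.2
      ⟨(hμ.pointwise u u' d hu).mono fun x hx => hx.trans le_self_add,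
        (hν.pointwise u u' d hu).mono fun x hx => hx.trans le_add_self⟩

theorem map_neg (h : HardyMomentBounds α μ C) :
    HardyMomentBounds α (μ.map fun x => -x) C := by
  have hneg : MeasurableEmbedding fun x : ℝ => -x := (Homeomorph.neg ℝ).measurableEmbedding
  refine ⟨h.one_le, fun k k' hk hk' => ?_, fun u u' d hu => ?_, fun u u' d hu => ?_⟩
  · have hderiv (x : ℝ) : HasDerivAt (fun x => k (-x)) (-k' (-x)) x := by
      simpa [Function.comp_def] using (hk (-x)).comp x (hasDerivAt_neg x)
    simpa [hneg.lintegral_map] using h.hardy _ _ hderiv (by fun_prop)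
  · simpa [rootEnergy, hneg.lintegral_map] using h.moment _ _ _ hu.comp_neg
  · simpa [rootEnergy, hneg.lintegral_map, hneg.ae_map_iff] using h.pointwise _ _ _ hu.comp_neg

theorem ae_log_div_le (h : HardyMomentBounds α μ C) {u u' d : ℝ → ℝ}
    (hu : RootGradientBound α u u' d) {t : ℝ} (ht : 0 < t)
    (ht_energy : rootEnergy α μ u d ≤ ENNReal.ofReal t) :
    ∀ᵐ x ∂μ, Real.log (u x / t) ≤ C * (1 + (1 + |x|) ^ α) := by
  have hC : 0 < C := zero_lt_one.trans_le h.one_le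
  filter_upwards [h.pointwise u u' d hu] with x hx
  have hbound : u x / t ≤ C * Real.exp (C * (1 + |x|) ^ α) := by
    rw [div_le_iff₀ ht, ← ENNReal.ofReal_le_ofReal_iff (by positivity),
      ENNReal.ofReal_mul (by positivity)]
    exact hx.trans (by gcongr)
  rcases (hu.nonneg x).eq_or_lt' with hux | hux
  · rw [hux, zero_div, Real.log_zero]
    positivity
  calc Real.log (u x / t) ≤ Real.log (C * Real.exp (C * (1 + |x|) ^ α)) :=
        Real.log_le_log (by positivity) hbound
    _ = Real.log C + C * (1 + |x|) ^ α := by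
        rw [Real.log_mul hC.ne' (Real.exp_pos _).ne', Real.log_exp]
    _ ≤ C * (1 + (1 + |x|) ^ α) := by linarith [Real.log_le_sub_one_of_pos hC]

end HardyMomentBounds

theorem sub_le_mul_log_div {y t : ℝ} (hy : 0 ≤ y) (ht : 0 < t) :
    y - t ≤ y * Real.log (y / t) := by
  rcases hy.eq_or_lt with rfl | hy
  · simpa using ht.le
  calc y - t = y * (1 - (y / t)⁻¹) := by field_simp
    _ ≤ y * Real.log (y / t) := by
        gcongr
        exact Real.one_sub_inv_le_log_of_pos (by positivity)

theorem entropy_of_integral_eq_zero {μ : Measure ℝ} {g : ℝ → ℝ} (h : ∫ x, g x ∂μ = 0) :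
    entropy μ g = 0 := by
  simp [entropy, h]

theorem integral_mul_log_div_integral_le {μ : Measure ℝ} [IsProbabilityMeasure μ] {g : ℝ → ℝ}
    (hg : Integrable g μ) (hg0 : ∀ x, 0 ≤ g x) (hN : 0 < ∫ x, g x ∂μ) {t : ℝ} (ht : 0 < t)
    (hF : Integrable (fun x => g x * Real.log (g x / t) - g x + t) μ) :
    Integrable (fun x => g x * Real.log (g x / ∫ y, g y ∂μ)) μ ∧
      ∫ x, g x * Real.log (g x / ∫ y, g y ∂μ) ∂μ ≤
        ∫ x, (g x * Real.log (g x / t) - g x + t) ∂μ := by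
  set N := ∫ x, g x ∂μ
  have hsplit : ∀ x, g x * Real.log (g x / N) =
      (g x * Real.log (g x / t) - g x + t) + (g x * (1 + Real.log (t / N)) - t) := by
    intro x
    rcases (hg0 x).eq_or_lt' with hx | hx
    · simp [hx]
    · rw [show g x / N = g x / t * (t / N) by field_simp,
        Real.log_mul (by positivity) (by positivity)]
      ring
  have hrest : Integrable (fun x => g x * (1 + Real.log (t / N)) - t) μ :=
    (hg.mul_const _).sub (integrable_const t)
  have hlog : N * Real.log (t / N) ≤ t - N := by
    calc N * Real.log (t / N) ≤ N * (t / N - 1) := by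
          gcongr
          exact Real.log_le_sub_one_of_pos (by positivity)
      _ = t - N := by field_simp
  simp_rw [hsplit]
  refine ⟨hF.add hrest, ?_⟩
  rw [integral_add hF hrest, integral_sub (hg.mul_const _) (integrable_const t),
    integral_mul_const, integral_const, probReal_univ, one_smul]
  linarith

theorem entropy_le_lintegral {μ : Measure ℝ} [IsProbabilityMeasure μ] {g : ℝ → ℝ}
    (hg : Integrable g μ) (hg0 : ∀ x, 0 ≤ g x) {t : ℝ} (ht : 0 < t) :
    entropy μ g ≤ ∫⁻ x, ENNReal.ofReal (g x * Real.log (g x / t) - g x + t) ∂μ := by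
  have hF0 : ∀ x, 0 ≤ g x * Real.log (g x / t) - g x + t :=
    fun x => by linarith [sub_le_mul_log_div (hg0 x) ht]
  have hN0 : 0 ≤ ∫ x, g x ∂μ := integral_nonneg hg0
  rcases hN0.eq_or_lt' with hN | hN
  · rw [entropy_of_integral_eq_zero hN]
    exact EReal.coe_ennreal_nonneg _
  rcases eq_or_ne (∫⁻ x, ENNReal.ofReal (g x * Real.log (g x / t) - g x + t) ∂μ) ⊤
    with htop | htop
  · rw [htop]
    exact le_top
  have hlog_meas : AEStronglyMeasurable (fun x => g x * Real.log (g x / t)) μ :=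
    (hg.aemeasurable.mul (hg.aemeasurable.div_const t).log).aestronglyMeasurable
  have hF : Integrable (fun x => g x * Real.log (g x / t) - g x + t) μ :=
    ⟨(hlog_meas.sub hg.aestronglyMeasurable).add aestronglyMeasurable_const,
      (hasFiniteIntegral_iff_ofReal (ae_of_all _ hF0)).2 htop.lt_top⟩
  obtain ⟨hint, hle⟩ := integral_mul_log_div_integral_le hg hg0 hN ht hF
  rw [entropy, if_pos hint, ← ofReal_integral_eq_lintegral_ofReal hF (ae_of_all _ hF0),
    EReal.coe_ennreal_ofReal, max_eq_left (integral_nonneg hF0)]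
  exact_mod_cast hle

theorem HardyMomentBounds.entropy_le_rootEnergy {α C : ℝ} {μ : Measure ℝ}
    [IsProbabilityMeasure μ] (h : HardyMomentBounds α μ C) {u u' d : ℝ → ℝ}
    (hu : RootGradientBound α u u' d) (hu_int : Integrable u μ) :
    entropy μ u ≤ (ENNReal.ofReal (C + C * C + 1) * rootEnergy α μ u d : ℝ≥0∞) := by
  have hC : 0 ≤ C := zero_le_one.trans h.one_le
  have hu_le := hu.lintegral_le_rootEnergy μ
  rcases eq_or_ne (rootEnergy α μ u d) ⊤ with htop | htop
  · rw [htop, ENNReal.mul_top (ENNReal.ofReal_pos.2 (by positivity)).ne']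
    exact le_top
  rcases (ENNReal.toReal_nonneg : 0 ≤ (rootEnergy α μ u d).toReal).eq_or_lt' with hzero | ht
  · have hN : ∫ x, u x ∂μ = 0 := by
      rw [integral_eq_lintegral_of_nonneg_ae (ae_of_all _ hu.nonneg) hu_int.aestronglyMeasurable]
      exact le_antisymm ((ENNReal.toReal_mono htop hu_le).trans hzero.le) ENNReal.toReal_nonneg
    rw [entropy_of_integral_eq_zero hN]
    exact EReal.coe_ennreal_nonneg _
  set D := rootEnergy α μ u d
  set t := D.toReal
  have htD : ENNReal.ofReal t = D := ENNReal.ofReal_toReal htop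
  have hu_meas := hu.continuous.measurable
  refine (entropy_le_lintegral hu_int hu.nonneg ht).trans
    (EReal.coe_ennreal_le_coe_ennreal_iff.2 ?_)
  calc _ ≤ ∫⁻ x, (ENNReal.ofReal C * ENNReal.ofReal (u x) +
        ENNReal.ofReal C * ENNReal.ofReal ((1 + |x|) ^ α * u x) + ENNReal.ofReal t) ∂μ := by
        refine lintegral_mono_ae ?_
        filter_upwards [h.ae_log_div_le hu ht htD.ge] with x hx
        have hux := hu.nonneg x
        rw [← ENNReal.ofReal_mul hC, ← ENNReal.ofReal_mul hC,
          ← ENNReal.ofReal_add (by positivity) (by positivity),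
          ← ENNReal.ofReal_add (by positivity) ht.le]
        refine ENNReal.ofReal_le_ofReal ?_
        nlinarith [mul_le_mul_of_nonneg_left hx hux]
    _ = ENNReal.ofReal C * ∫⁻ x, ENNReal.ofReal (u x) ∂μ +
        ENNReal.ofReal C * ∫⁻ x, ENNReal.ofReal ((1 + |x|) ^ α * u x) ∂μ + D := by
        rw [lintegral_add_right _ measurable_const, lintegral_add_left (by fun_prop),
          lintegral_const_mul' _ _ ENNReal.ofReal_ne_top,
          lintegral_const_mul' _ _ ENNReal.ofReal_ne_top, lintegral_const, measure_univ, mul_one,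
          htD]
    _ ≤ ENNReal.ofReal C * D + ENNReal.ofReal C * (ENNReal.ofReal C * D) + D := by
        gcongr
        exact h.moment u u' d hu
    _ = ENNReal.ofReal (C + C * C + 1) * D := by
        rw [ENNReal.ofReal_add (by positivity) zero_le_one,
          ENNReal.ofReal_add (by positivity) (by positivity), ENNReal.ofReal_mul hC,
          ENNReal.ofReal_one]
        ring

/-- The integral of `f'² + 2^β |f'/f|^β f²`, which is comparable to the right-hand side of the
logarithmic Sobolev inequality. -/
noncomputable def mixedEnergy (α : ℝ) (μ : Measure ℝ) (f f' : ℝ → ℝ) : ℝ≥0∞ :=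
  ∫⁻ x, ENNReal.ofReal (f' x ^ 2 + rootGradient α.conjExponent f f' x ^ α.conjExponent) ∂μ

theorem mixedEnergy_div_const {α : ℝ} (hα : 1 < α) (μ : Measure ℝ) (f f' : ℝ → ℝ) {m : ℝ}
    (hm : m ≠ 0) :
    mixedEnergy α μ (fun x => f x / m) (fun x => f' x / m) =
      ENNReal.ofReal (m ^ 2)⁻¹ * mixedEnergy α μ f f' := by
  have hβ : α.conjExponent ≠ 0 := (Real.HolderConjugate.conjExponent hα).symm.ne_zero
  rw [mixedEnergy, mixedEnergy, ← lintegral_const_mul' _ _ ENNReal.ofReal_ne_top]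
  refine lintegral_congr fun x => ?_
  rw [← ENNReal.ofReal_mul (by positivity), rootGradient_rpow hβ, rootGradient_rpow hβ,
    div_div_div_cancel_right₀ hm]
  congr 1
  ring

theorem lintegral_deriv_sq_le_mixedEnergy (α : ℝ) (μ : Measure ℝ) (f f' : ℝ → ℝ) :
    ∫⁻ x, ENNReal.ofReal (f' x ^ 2) ∂μ ≤ mixedEnergy α μ f f' :=
  lintegral_mono fun _ => ENNReal.ofReal_le_ofReal <|
    le_add_of_nonneg_right (Real.rpow_nonneg (rootGradient_nonneg _ _ _ _) _)

theorem rootEnergy_le_lintegral_add_mixedEnergy {α : ℝ} (μ : Measure ℝ) {u f f' : ℝ → ℝ}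
    (hu : Measurable u) (hu0 : ∀ x, 0 ≤ u x) :
    rootEnergy α μ u (rootGradient α.conjExponent f f') ≤
      ∫⁻ x, ENNReal.ofReal (u x) ∂μ + mixedEnergy α μ f f' := by
  rw [mixedEnergy, ← lintegral_add_left hu.ennreal_ofReal]
  refine lintegral_mono fun x => ?_
  have hgrad := Real.rpow_nonneg (rootGradient_nonneg α.conjExponent f f' x) α.conjExponent
  rw [← ENNReal.ofReal_add (hu0 x) (by positivity)]
  exact ENNReal.ofReal_le_ofReal (by linarith [sq_nonneg (f' x)])

theorem lintegral_sq_le {μ : Measure ℝ} [IsProbabilityMeasure μ] {f : ℝ → ℝ} (m : ℝ) :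
    ∫⁻ x, ENNReal.ofReal (f x ^ 2) ∂μ ≤
      2 * ∫⁻ x, ENNReal.ofReal ((f x - m) ^ 2) ∂μ + 2 * ENNReal.ofReal (m ^ 2) := by
  calc _ ≤ ∫⁻ x, (2 * ENNReal.ofReal ((f x - m) ^ 2) + 2 * ENNReal.ofReal (m ^ 2)) ∂μ := by
        refine lintegral_mono fun x => ?_
        rw [← ENNReal.ofReal_ofNat 2, ← ENNReal.ofReal_mul zero_le_two,
          ← ENNReal.ofReal_mul zero_le_two, ← ENNReal.ofReal_add (by positivity) (by positivity)]
        exact ENNReal.ofReal_le_ofReal (by nlinarith [sq_nonneg (f x - 2 * m)])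
    _ = _ := by
        rw [lintegral_add_right _ measurable_const, lintegral_const, measure_univ, mul_one,
          lintegral_const_mul' _ _ ENNReal.ofNat_ne_top]

namespace HardyMomentBounds

variable {α C : ℝ} {μ : Measure ℝ}

theorem lintegral_sub_sq_le_mixedEnergy (h : HardyMomentBounds α μ C) {f f' : ℝ → ℝ}
    (hf : ∀ x, HasDerivAt f (f' x) x) (hf' : Continuous f') :
    ∫⁻ x, ENNReal.ofReal ((f x - f 0) ^ 2) ∂μ ≤ ENNReal.ofReal C * mixedEnergy α μ f f' :=
  (h.hardy f f' hf hf').trans (mul_le_mul' le_rfl (lintegral_deriv_sq_le_mixedEnergy _ _ _ _))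

theorem entropy_sq_le_of_le_lintegral_sub_sq [IsProbabilityMeasure μ]
    (h : HardyMomentBounds α μ C) (hα : 1 < α) {f f' : ℝ → ℝ}
    (hf : ∀ x, HasDerivAt f (f' x) x) (hf' : Continuous f')
    (hf_int : Integrable (fun x => f x ^ 2) μ)
    (hle : ENNReal.ofReal (f 0 ^ 2) ≤ ∫⁻ x, ENNReal.ofReal ((f x - f 0) ^ 2) ∂μ) :
    entropy μ (fun x => f x ^ 2) ≤
      (ENNReal.ofReal ((C + C * C + 1) * (4 * C + 1)) * mixedEnergy α μ f f' : ℝ≥0∞) := by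
  have hC : 0 ≤ C := zero_le_one.trans h.one_le
  have hsq := rootGradientBound_sq hα hf hf'
  refine (h.entropy_le_rootEnergy hsq hf_int).trans (EReal.coe_ennreal_le_coe_ennreal_iff.2 ?_)
  rw [ENNReal.ofReal_mul (by positivity), mul_assoc]
  gcongr
  set E := mixedEnergy α μ f f'
  have hsub := h.lintegral_sub_sq_le_mixedEnergy hf hf'
  calc _ ≤ ∫⁻ x, ENNReal.ofReal (f x ^ 2) ∂μ + E :=
        rootEnergy_le_lintegral_add_mixedEnergy μ hsq.continuous.measurable hsq.nonneg
    _ ≤ 2 * (ENNReal.ofReal C * E) + 2 * (ENNReal.ofReal C * E) + E := by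
        gcongr
        refine (lintegral_sq_le (f 0)).trans ?_
        gcongr
        exact hle.trans hsub
    _ = ENNReal.ofReal (4 * C + 1) * E := by
        rw [ENNReal.ofReal_add (by positivity) zero_le_one, ENNReal.ofReal_mul zero_le_four,
          ENNReal.ofReal_one, ENNReal.ofReal_ofNat]
        ring

theorem ae_log_sq_le [IsProbabilityMeasure μ] (h : HardyMomentBounds α μ C) (hα : 1 < α)
    {g g' : ℝ → ℝ} (hg : ∀ x, HasDerivAt g (g' x) x) (hg' : Continuous g')
    (hnear : ∫⁻ x, ENNReal.ofReal ((g x - 1) ^ 2) ∂μ ≤ 1) (hE : mixedEnergy α μ g g' ≠ ⊤) :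
    ∀ᵐ x ∂μ, Real.log (g x ^ 2) ≤
      C + 4 + (mixedEnergy α μ g g').toReal + C * (1 + |x|) ^ α := by
  have hC : 0 ≤ C := zero_le_one.trans h.one_le
  set e := (mixedEnergy α μ g g').toReal
  have he : 0 ≤ e := ENNReal.toReal_nonneg
  have hsq := rootGradientBound_sq hα hg hg'
  have henergy : rootEnergy α μ (fun x => g x ^ 2) (rootGradient α.conjExponent g g') ≤
      ENNReal.ofReal (4 + e) := by
    calc _ ≤ ∫⁻ x, ENNReal.ofReal (g x ^ 2) ∂μ + mixedEnergy α μ g g' :=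
          rootEnergy_le_lintegral_add_mixedEnergy μ hsq.continuous.measurable hsq.nonneg
      _ ≤ 2 * 1 + 2 * 1 + mixedEnergy α μ g g' := by
          gcongr
          refine (lintegral_sq_le 1).trans ?_
          rw [one_pow, ENNReal.ofReal_one]
          gcongr
      _ = ENNReal.ofReal (4 + e) := by
          rw [ENNReal.ofReal_add zero_le_four he, ENNReal.ofReal_toReal hE, ENNReal.ofReal_ofNat]
          norm_num
  filter_upwards [h.ae_log_div_le hsq (by positivity : 0 < 4 + e) henergy] with x hx
  rcases eq_or_ne (g x) 0 with h0 | h0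
  · rw [h0, zero_pow two_ne_zero, Real.log_zero]
    positivity
  rw [Real.log_div (by positivity) (by positivity)] at hx
  linarith [Real.log_le_sub_one_of_pos (by positivity : 0 < 4 + e)]

end HardyMomentBounds

theorem two_le_conjExponent {α : ℝ} (hα : 1 < α) (hα2 : α ≤ 2) : 2 ≤ α.conjExponent := by
  rw [Real.conjExponent, le_div_iff₀ (by linarith)]
  linarith

namespace HardyMomentBounds

variable {α C : ℝ} {μ : Measure ℝ}

theorem lintegral_rootTrunc_le_mixedEnergy (h : HardyMomentBounds α μ C) (hα : 1 < α)
    (hα2 : α ≤ 2) {g g' : ℝ → ℝ} (hg : ∀ x, HasDerivAt g (g' x) x) (hg' : Continuous g')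
    (hg0 : g 0 = 1) :
    ∫⁻ x, ENNReal.ofReal (rootTrunc α.conjExponent (g x ^ 2)) ∂μ ≤
      ENNReal.ofReal C * mixedEnergy α μ g g' :=
  calc _ ≤ ∫⁻ x, ENNReal.ofReal ((g x - g 0) ^ 2) ∂μ := lintegral_mono fun x =>
        ENNReal.ofReal_le_ofReal (hg0 ▸ rootTrunc_sq_le (two_le_conjExponent hα hα2) (g x))
    _ ≤ _ := h.lintegral_sub_sq_le_mixedEnergy hg hg'

theorem lintegral_moment_rootTrunc_le_mixedEnergy (h : HardyMomentBounds α μ C) (hα : 1 < α)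
    (hα2 : α ≤ 2) {g g' : ℝ → ℝ} (hg : ∀ x, HasDerivAt g (g' x) x) (hg' : Continuous g')
    (hg0 : g 0 = 1) :
    ∫⁻ x, ENNReal.ofReal ((1 + |x|) ^ α * rootTrunc α.conjExponent (g x ^ 2)) ∂μ ≤
      ENNReal.ofReal C *
        (ENNReal.ofReal C * mixedEnergy α μ g g' + mixedEnergy α μ g g') := by
  have hw := (rootGradientBound_sq hα hg hg').rootTrunc_comp hα
  refine (h.moment _ _ _ hw).trans (mul_le_mul' le_rfl ?_)
  exact (rootEnergy_le_lintegral_add_mixedEnergy μ hw.continuous.measurable hw.nonneg).trans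
    (add_le_add_left (h.lintegral_rootTrunc_le_mixedEnergy hα hα2 hg hg' hg0) _)

theorem lintegral_rootTrunc_mul_le (h : HardyMomentBounds α μ C) (hα : 1 < α)
    (hα2 : α ≤ 2) {g g' : ℝ → ℝ} (hg : ∀ x, HasDerivAt g (g' x) x) (hg' : Continuous g')
    (hg0 : g 0 = 1) (hnear : ∫⁻ x, ENNReal.ofReal ((g x - 1) ^ 2) ∂μ ≤ 1)
    (hE : mixedEnergy α μ g g' ≠ ⊤) :
    ∫⁻ x, ENNReal.ofReal (rootTrunc α.conjExponent (g x ^ 2) *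
        (C + 4 + (mixedEnergy α μ g g').toReal + C * (1 + |x|) ^ α)) ∂μ ≤
      ENNReal.ofReal ((C + 4) * C + 1 + C * (C * (C + 1))) * mixedEnergy α μ g g' := by
  have hC : 0 ≤ C := zero_le_one.trans h.one_le
  have hw := (rootGradientBound_sq hα hg hg').rootTrunc_comp hα
  have hw_meas := hw.continuous.measurable
  set w := fun x => rootTrunc α.conjExponent (g x ^ 2)
  have hw_le_one : ∫⁻ x, ENNReal.ofReal (w x) ∂μ ≤ 1 := (lintegral_mono fun x =>
    ENNReal.ofReal_le_ofReal (rootTrunc_sq_le (two_le_conjExponent hα hα2) (g x))).trans hnear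
  set E := mixedEnergy α μ g g'
  set e := E.toReal with he_def
  have he : 0 ≤ e := ENNReal.toReal_nonneg
  calc _ = ∫⁻ x, (ENNReal.ofReal (C + 4) * ENNReal.ofReal (w x) +
        ENNReal.ofReal e * ENNReal.ofReal (w x) +
        ENNReal.ofReal C * ENNReal.ofReal ((1 + |x|) ^ α * w x)) ∂μ := by
        refine lintegral_congr fun x => ?_
        have hwx := hw.nonneg x
        rw [← ENNReal.ofReal_mul (by positivity), ← ENNReal.ofReal_mul he,
          ← ENNReal.ofReal_mul hC, ← ENNReal.ofReal_add (by positivity) (by positivity),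
          ← ENNReal.ofReal_add (by positivity) (by positivity)]
        congr 1
        ring
    _ = ENNReal.ofReal (C + 4) * ∫⁻ x, ENNReal.ofReal (w x) ∂μ +
        E * ∫⁻ x, ENNReal.ofReal (w x) ∂μ +
        ENNReal.ofReal C * ∫⁻ x, ENNReal.ofReal ((1 + |x|) ^ α * w x) ∂μ := by
        rw [lintegral_add_left (by fun_prop), lintegral_add_left (by fun_prop)]
        simp only [lintegral_const_mul' _ _ ENNReal.ofReal_ne_top]
        rw [he_def, ENNReal.ofReal_toReal hE]
    _ ≤ ENNReal.ofReal (C + 4) * (ENNReal.ofReal C * E) + E * 1 +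
        ENNReal.ofReal C * (ENNReal.ofReal C * (ENNReal.ofReal C * E + E)) := by
        gcongr
        exacts [h.lintegral_rootTrunc_le_mixedEnergy hα hα2 hg hg' hg0,
          h.lintegral_moment_rootTrunc_le_mixedEnergy hα hα2 hg hg' hg0]
    _ = _ := by
        rw [ENNReal.ofReal_add (q := C * (C * (C + 1))) (by positivity) (by positivity),
          ENNReal.ofReal_add (q := 1) (by positivity) zero_le_one,
          ENNReal.ofReal_mul (p := C + 4) (by positivity), ENNReal.ofReal_mul (q := C * (C + 1)) hC,
          ENNReal.ofReal_mul (q := C + 1) hC, ENNReal.ofReal_add (q := 1) hC zero_le_one,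
          ENNReal.ofReal_one]
        ring

theorem exists_lintegral_sq_mul_log_le [IsProbabilityMeasure μ] (h : HardyMomentBounds α μ C)
    (hα : 1 < α) (hα2 : α ≤ 2) :
    ∃ A : ℝ, 0 < A ∧ ∀ g g' : ℝ → ℝ, (∀ x, HasDerivAt g (g' x) x) → Continuous g' → g 0 = 1 →
      ∫⁻ x, ENNReal.ofReal ((g x - 1) ^ 2) ∂μ ≤ 1 →
      ∫⁻ x, ENNReal.ofReal (g x ^ 2 * Real.log (g x ^ 2) - g x ^ 2 + 1) ∂μ ≤
        ENNReal.ofReal A * mixedEnergy α μ g g' := by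
  have hβ : 0 < α.conjExponent := zero_lt_two.trans_le (two_le_conjExponent hα hα2)
  have hC : 0 < C := zero_lt_one.trans_le h.one_le
  set K : ℝ := 2 ^ α.conjExponent
  have hK : 0 < K := by positivity
  refine ⟨2 * (K + 1) * C + K * ((C + 4) * C + 1 + C * (C * (C + 1))), by positivity,
    fun g g' hg hg' hg0 hnear => ?_⟩
  rcases eq_or_ne (mixedEnergy α μ g g') ⊤ with hE | hE
  · rw [hE, ENNReal.mul_top (ENNReal.ofReal_pos.2 (by positivity)).ne']
    exact le_top
  have hg_meas := (continuous_iff_continuousAt.2 fun x => (hg x).continuousAt).measurable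
  set e := (mixedEnergy α μ g g').toReal
  calc _ ≤ ∫⁻ x, (ENNReal.ofReal (2 * (K + 1)) * ENNReal.ofReal ((g x - 1) ^ 2) +
        ENNReal.ofReal K * ENNReal.ofReal (rootTrunc α.conjExponent (g x ^ 2) *
          (C + 4 + e + C * (1 + |x|) ^ α))) ∂μ := by
        refine lintegral_mono_ae ?_
        filter_upwards [h.ae_log_sq_le hα hg hg' hnear hE] with x hx
        have hw := rootTrunc_nonneg hβ.le (g x ^ 2)
        rw [← ENNReal.ofReal_mul (by positivity), ← ENNReal.ofReal_mul hK.le,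
          ← ENNReal.ofReal_add (by positivity) (by positivity)]
        exact ENNReal.ofReal_le_ofReal (sq_mul_log_sub_add_one_le hβ (by positivity) hx)
    _ = ENNReal.ofReal (2 * (K + 1)) * ∫⁻ x, ENNReal.ofReal ((g x - 1) ^ 2) ∂μ +
        ENNReal.ofReal K * ∫⁻ x, ENNReal.ofReal (rootTrunc α.conjExponent (g x ^ 2) *
          (C + 4 + e + C * (1 + |x|) ^ α)) ∂μ := by
        rw [lintegral_add_left (by fun_prop)]
        simp only [lintegral_const_mul' _ _ ENNReal.ofReal_ne_top]
    _ ≤ _ := by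
        rw [ENNReal.ofReal_add (by positivity) (by positivity), add_mul,
          ENNReal.ofReal_mul (p := 2 * (K + 1)) (by positivity), ENNReal.ofReal_mul (p := K) hK.le,
          mul_assoc (ENNReal.ofReal (2 * (K + 1))), mul_assoc (ENNReal.ofReal K)]
        refine add_le_add (mul_le_mul' le_rfl ?_) (mul_le_mul' le_rfl ?_)
        · simpa only [hg0] using h.lintegral_sub_sq_le_mixedEnergy hg hg'
        · exact h.lintegral_rootTrunc_mul_le hα hα2 hg hg' hg0 hnear hE

theorem exists_entropy_sq_le_of_lintegral_sub_sq_lt [IsProbabilityMeasure μ]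
    (h : HardyMomentBounds α μ C) (hα : 1 < α) (hα2 : α ≤ 2) :
    ∃ A : ℝ, 0 < A ∧ ∀ f f' : ℝ → ℝ, (∀ x, HasDerivAt f (f' x) x) → Continuous f' →
      Integrable (fun x => f x ^ 2) μ →
      ∫⁻ x, ENNReal.ofReal ((f x - f 0) ^ 2) ∂μ < ENNReal.ofReal (f 0 ^ 2) →
      entropy μ (fun x => f x ^ 2) ≤ (ENNReal.ofReal A * mixedEnergy α μ f f' : ℝ≥0∞) := by
  obtain ⟨A, hA, hlog⟩ := h.exists_lintegral_sq_mul_log_le hα hα2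
  refine ⟨A, hA, fun f f' hf hf' hf_int hlt => ?_⟩
  set m := f 0
  have hm2 : 0 < m ^ 2 := ENNReal.ofReal_pos.1 (pos_of_gt hlt)
  have hm : m ≠ 0 := fun h0 => by simp [h0] at hm2
  have hcancel : ENNReal.ofReal (m ^ 2) * ENNReal.ofReal (m ^ 2)⁻¹ = 1 := by
    rw [← ENNReal.ofReal_mul hm2.le, mul_inv_cancel₀ hm2.ne', ENNReal.ofReal_one]
  have hnear : ∫⁻ x, ENNReal.ofReal ((f x / m - 1) ^ 2) ∂μ ≤ 1 := by
    have hscale (x : ℝ) : ENNReal.ofReal ((f x / m - 1) ^ 2) =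
        ENNReal.ofReal (m ^ 2)⁻¹ * ENNReal.ofReal ((f x - m) ^ 2) := by
      rw [← ENNReal.ofReal_mul (by positivity)]
      congr 1
      field_simp
    simp_rw [hscale]
    rw [lintegral_const_mul' _ _ ENNReal.ofReal_ne_top, ← hcancel, mul_comm]
    gcongr
  have hentropy (x : ℝ) : ENNReal.ofReal (f x ^ 2 * Real.log (f x ^ 2 / m ^ 2) - f x ^ 2 + m ^ 2) =
      ENNReal.ofReal (m ^ 2) * ENNReal.ofReal
        ((f x / m) ^ 2 * Real.log ((f x / m) ^ 2) - (f x / m) ^ 2 + 1) := by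
    rw [← ENNReal.ofReal_mul hm2.le, div_pow]
    congr 1
    field_simp
  refine (entropy_le_lintegral hf_int (fun x => sq_nonneg _) hm2).trans
    (EReal.coe_ennreal_le_coe_ennreal_iff.2 ?_)
  simp_rw [hentropy]
  rw [lintegral_const_mul' _ _ ENNReal.ofReal_ne_top]
  calc _ ≤ ENNReal.ofReal (m ^ 2) *
        (ENNReal.ofReal A * (ENNReal.ofReal (m ^ 2)⁻¹ * mixedEnergy α μ f f')) := by
        rw [← mixedEnergy_div_const hα μ f f' hm]
        gcongr
        exact hlog _ _ (fun x => (hf x).div_const m) (hf'.div_const m) (div_self hm) hnear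
    _ = ENNReal.ofReal (m ^ 2) * ENNReal.ofReal (m ^ 2)⁻¹ *
        (ENNReal.ofReal A * mixedEnergy α μ f f') := by ring
    _ = ENNReal.ofReal A * mixedEnergy α μ f f' := by rw [hcancel, one_mul]

theorem exists_entropy_sq_le [IsProbabilityMeasure μ] (h : HardyMomentBounds α μ C)
    (hα : 1 < α) (hα2 : α ≤ 2) :
    ∃ A : ℝ, 0 < A ∧ ∀ f f' : ℝ → ℝ, (∀ x, HasDerivAt f (f' x) x) → Continuous f' →
      Integrable (fun x => f x ^ 2) μ →
      entropy μ (fun x => f x ^ 2) ≤ (ENNReal.ofReal A * mixedEnergy α μ f f' : ℝ≥0∞) := by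
  obtain ⟨A, hA, hnear⟩ := h.exists_entropy_sq_le_of_lintegral_sub_sq_lt hα hα2
  refine ⟨max A ((C + C * C + 1) * (4 * C + 1)), lt_max_of_lt_left hA,
    fun f f' hf hf' hf_int => ?_⟩
  rcases lt_or_ge (∫⁻ x, ENNReal.ofReal ((f x - f 0) ^ 2) ∂μ) (ENNReal.ofReal (f 0 ^ 2))
    with hlt | hge
  · refine (hnear f f' hf hf' hf_int hlt).trans (EReal.coe_ennreal_le_coe_ennreal_iff.2 ?_)
    gcongr
    exact le_max_left _ _
  · refine (h.entropy_sq_le_of_le_lintegral_sub_sq hα hf hf' hf_int hge).trans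
      (EReal.coe_ennreal_le_coe_ennreal_iff.2 ?_)
    gcongr
    exact le_max_right _ _

end HardyMomentBounds

theorem ae_deriv_eq_zero_of_eq_zero {f f' : ℝ → ℝ} (hf : ∀ x, HasDerivAt f (f' x) x) :
    ∀ᵐ x, f x = 0 → f' x = 0 := by
  set s : Set ℝ := {x | f x = 0 ∧ f' x ≠ 0}
  have hcount : s.Countable := by
    refine Set.Countable.mono (fun x hx => ?_) (countable_setOfPred_isolated_right_within (s := s))
    refine ⟨hx, Filter.empty_mem_iff_bot.1 ?_⟩
    have hne : {z | f z ≠ 0} ∈ nhdsWithin x (s ∩ Ioi x) :=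
      nhdsWithin_mono x (fun z hz => ne_of_gt hz.2) ((hf x).eventually_ne hx.2)
    filter_upwards [hne, self_mem_nhdsWithin] with z hz hz'
    exact hz hz'.1.1
  filter_upwards [hcount.ae_notMem volume] with x hx h0
  by_contra hx'
  exact hx ⟨h0, hx'⟩

theorem exists_sq_add_rpow_le_H {a α : ℝ} (ha : 0 < a) (hα : 1 < α) (hα2 : α ≤ 2) :
    ∃ C : ℝ, 0 < C ∧ ∀ t, t ^ 2 + 2 ^ α.conjExponent * |t| ^ α.conjExponent ≤ C * H a α t := by
  have hβ := two_le_conjExponent hα hα2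
  simp only [H]
  set β := α.conjExponent
  set A : ℝ := 1 + 2 ^ β * a ^ (β - 2) with hA
  refine ⟨(2 + β) * A, by positivity, fun t => ?_⟩
  split_ifs with hta
  · have hpow : |t| ^ β ≤ a ^ (β - 2) * t ^ 2 := by
      calc |t| ^ β = |t| ^ (β - 2) * t ^ 2 := by
            rw [← sq_abs t, ← Real.rpow_two, ← Real.rpow_add_of_nonneg (abs_nonneg t)
              (by linarith) zero_le_two, sub_add_cancel]
        _ ≤ _ := by gcongr
    calc t ^ 2 + 2 ^ β * |t| ^ β ≤ t ^ 2 + 2 ^ β * (a ^ (β - 2) * t ^ 2) := by gcongr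
      _ = 2 * A * (t ^ 2 / 2) := by rw [hA]; ring
      _ ≤ (2 + β) * A * (t ^ 2 / 2) := by gcongr; linarith
  · have hta : a < |t| := not_le.1 hta
    set P := a ^ (2 - β) * |t| ^ β with hP
    have hsq : t ^ 2 ≤ P := by
      calc t ^ 2 = |t| ^ (2 - β) * |t| ^ β := by
            rw [← Real.rpow_add (ha.trans hta), sub_add_cancel, Real.rpow_two, sq_abs]
        _ ≤ P := mul_le_mul_of_nonneg_right
            (Real.rpow_le_rpow_of_nonpos ha hta.le (by linarith)) (by positivity)
    have hpow : |t| ^ β = a ^ (β - 2) * P := by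
      rw [hP, ← mul_assoc, ← Real.rpow_add ha, sub_add_sub_cancel, sub_self, Real.rpow_zero,
        one_mul]
    have hdefect : 0 ≤ a ^ 2 * ((β - 2) / (2 * β)) :=
      mul_nonneg (sq_nonneg a) (div_nonneg (by linarith) (by linarith))
    calc t ^ 2 + 2 ^ β * |t| ^ β ≤ P + 2 ^ β * (a ^ (β - 2) * P) := by rw [hpow]; gcongr
      _ = β * A * (P / β) := by rw [hA]; field_simp
      _ ≤ (2 + β) * A * (P / β) := by gcongr; linarith
      _ ≤ (2 + β) * A * (a ^ (2 - β) * (|t| ^ β / β) + a ^ 2 * ((β - 2) / (2 * β))) := by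
          gcongr
          rw [hP, mul_div_assoc]
          exact le_add_of_nonneg_right hdefect

theorem exists_mixedEnergy_le_energy {a α : ℝ} (ha : 0 < a) (hα : 1 < α) (hα2 : α ≤ 2) :
    ∃ C : ℝ, 0 < C ∧ ∀ μ : Measure ℝ, μ ≪ volume →
      ∀ f : ℝ → ℝ, (∀ x, HasDerivAt f (deriv f x) x) →
      mixedEnergy α μ f (deriv f) ≤ ENNReal.ofReal C * energy a α μ f := by
  have hβ : α.conjExponent ≠ 0 := (Real.HolderConjugate.conjExponent hα).symm.ne_zero
  obtain ⟨C, hC, hH⟩ := exists_sq_add_rpow_le_H ha hα hα2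
  refine ⟨C, hC, fun μ hμ f hf => ?_⟩
  rw [mixedEnergy, energy, ← lintegral_const_mul' _ _ ENNReal.ofReal_ne_top]
  refine lintegral_mono_ae ?_
  filter_upwards [hμ.ae_le (ae_deriv_eq_zero_of_eq_zero hf)] with x hx
  rw [rootGradient_rpow hβ, HLogDeriv]
  split_ifs with h0
  · simp [h0, hx h0]
  set t := deriv f x / f x
  have htf : deriv f x = t * f x := (div_mul_cancel₀ _ h0).symm
  rw [← mul_assoc (ENNReal.ofReal C), ← ENNReal.ofReal_mul hC.le,
    ← ENNReal.ofReal_mul (le_trans (by positivity) (hH t))]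
  refine ENNReal.ofReal_le_ofReal ?_
  calc deriv f x ^ 2 + 2 ^ α.conjExponent * (|t| ^ α.conjExponent * f x ^ 2)
      = (t ^ 2 + 2 ^ α.conjExponent * |t| ^ α.conjExponent) * f x ^ 2 := by rw [htf]; ring
    _ ≤ C * H a α t * f x ^ 2 := by gcongr; exact hH t

theorem HardyMomentBounds.exists_satisfiesLSI {a α C : ℝ} {μ : Measure ℝ}
    [IsProbabilityMeasure μ] (h : HardyMomentBounds α μ C) (hμ : μ ≪ volume) (ha : 0 < a)
    (hα : 1 < α) (hα2 : α ≤ 2) : ∃ C' : ℝ, 0 < C' ∧ SatisfiesLSI a α C' μ := by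
  obtain ⟨A, hA, hentropy⟩ := h.exists_entropy_sq_le hα hα2
  obtain ⟨B, hB, henergy⟩ := exists_mixedEnergy_le_energy ha hα hα2
  refine ⟨A * B, by positivity, fun f hf hf2 => ?_⟩
  have hderiv : ∀ x, HasDerivAt f (deriv f x) x :=
    fun x => (hf.differentiable (by simp) x).hasDerivAt
  refine (hentropy f (deriv f) hderiv (hf.continuous_deriv (by simp)) hf2.integrable_sq).trans
    (EReal.coe_ennreal_le_coe_ennreal_iff.2 ?_)
  rw [ENNReal.ofReal_mul hA.le, mul_assoc]
  gcongr
  exact henergy μ hμ f hderiv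

theorem isProbabilityMeasure_withDensity_div_integral {μ : Measure ℝ} {u : ℝ → ℝ}
    (hu : Integrable u μ) (hu0 : ∀ᵐ x ∂μ, 0 ≤ u x) (hpos : 0 < ∫ x, u x ∂μ) :
    IsProbabilityMeasure (μ.withDensity fun x => ENNReal.ofReal (u x / ∫ y, u y ∂μ)) where
  measure_univ := by
    rw [withDensity_apply _ MeasurableSet.univ, Measure.restrict_univ,
      ← ofReal_integral_eq_lintegral_ofReal (hu.div_const _)
        (hu0.mono fun x hx => div_nonneg hx hpos.le),
      integral_div, div_self hpos.ne', ENNReal.ofReal_one]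

theorem exp_neg_div_eq {Z : ℝ} (hZ : 0 < Z) (v : ℝ) :
    Real.exp (-v) / Z = Real.exp (-(v + Real.log Z)) := by
  rw [neg_add, Real.exp_add, Real.exp_neg (Real.log Z), Real.exp_log hZ, div_eq_mul_inv]

theorem integrable_comp_abs {u : ℝ → ℝ} (hu : IntegrableOn u (Ioi 0)) :
    Integrable fun x => u |x| := by
  have hpos : IntegrableOn (fun x => u |x|) (Ioi 0) :=
    hu.congr_fun (fun x hx => by rw [abs_of_pos hx]) measurableSet_Ioi
  rw [← integrableOn_univ, ← Iic_union_Ioi (a := (0 : ℝ))]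
  refine IntegrableOn.union ?_ hpos
  rw [integrableOn_Iic_iff_integrableOn_Iio]
  simpa using hpos.comp_neg

theorem withDensity_eq_add_map_neg {u : ℝ → ℝ≥0∞} (hu : Measurable u)
    (heven : ∀ x, u (-x) = u x) :
    volume.withDensity u = (volume.restrict (Ioi 0)).withDensity u +
      ((volume.restrict (Ioi 0)).withDensity u).map fun x => -x := by
  have hmap : ((volume.restrict (Ioi (0 : ℝ))).withDensity u).map (fun x => -x) =
      (volume.restrict (Iic (0 : ℝ))).withDensity u := by
    rw [Measure.restrict_congr_set (Iio_ae_eq_Iic (a := (0 : ℝ)) (μ := volume)).symm]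
    ext s hs
    have hpre : (fun x : ℝ => -x) ⁻¹' s ∩ Ioi 0 = (fun x : ℝ => -x) ⁻¹' (s ∩ Iio 0) := by
      ext x
      simp
    rw [Measure.map_apply measurable_neg hs, withDensity_apply _ (measurable_neg hs),
      withDensity_apply _ hs, Measure.restrict_restrict (measurable_neg hs),
      Measure.restrict_restrict hs, hpre, ← (Measure.measurePreserving_neg
        volume).setLIntegral_comp_preimage (hs.inter measurableSet_Iio) hu]
    simp_rw [heven]
  rw [hmap, ← withDensity_add_measure, ← compl_Ioi,
    Measure.restrict_add_restrict_compl measurableSet_Ioi]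

namespace HalfLinePotential

variable {a α : ℝ} {V q : ℝ → ℝ}

theorem isProbabilityMeasure_and_exists_satisfiesLSI (h : HalfLinePotential α V q) (ha : 0 < a)
    (hα : 1 < α) (hα2 : α ≤ 2) {μ : Measure ℝ}
    (hμ : μ = (volume.restrict (Ioi 0)).withDensity fun x =>
      ENNReal.ofReal (Real.exp (-V x) / ∫ y in Ioi 0, Real.exp (-V y))) :
    IsProbabilityMeasure μ ∧ ∃ C : ℝ, 0 < C ∧ SatisfiesLSI a α C μ := by
  have hint := h.integrableOn_exp_neg hα.le
  have : NeZero ((volume : Measure ℝ).restrict (Ioi 0)) := ⟨by simp [Measure.restrict_eq_zero]⟩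
  have hZ : 0 < ∫ y in Ioi 0, Real.exp (-V y) := integral_exp_pos hint
  have hprob : IsProbabilityMeasure μ := hμ ▸
    isProbabilityMeasure_withDensity_div_integral hint (ae_of_all _ fun x => (Real.exp_pos _).le) hZ
  simp_rw [exp_neg_div_eq hZ] at hμ
  obtain ⟨C, hC⟩ := (h.add_const (by linarith) _).exists_hardyMomentBounds hα
  rw [halfLineMeasure, ← hμ] at hC
  refine ⟨hprob, hC.exists_satisfiesLSI ?_ ha hα hα2⟩
  rw [hμ]
  exact (withDensity_absolutelyContinuous _ _).trans Measure.absolutelyContinuous_restrict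

theorem isProbabilityMeasure_and_exists_satisfiesLSI_of_even (h : HalfLinePotential α V q)
    (heven : ∀ x, V (-x) = V x) (ha : 0 < a) (hα : 1 < α) (hα2 : α ≤ 2) {μ : Measure ℝ}
    (hμ : μ = volume.withDensity fun x =>
      ENNReal.ofReal (Real.exp (-V x) / ∫ y, Real.exp (-V y))) :
    IsProbabilityMeasure μ ∧ ∃ C : ℝ, 0 < C ∧ SatisfiesLSI a α C μ := by
  have habs (x : ℝ) : V |x| = V x := by
    rcases abs_choice x with hx | hx <;> rw [hx]
    exact heven x
  have hV : Continuous V :=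
    (h.continuousOn.comp_continuous continuous_abs abs_nonneg).congr habs
  have hint : Integrable fun x => Real.exp (-V x) := by
    simpa only [habs] using integrable_comp_abs (h.integrableOn_exp_neg hα.le)
  have hZ : 0 < ∫ y, Real.exp (-V y) := integral_exp_pos hint
  have hprob : IsProbabilityMeasure μ := hμ ▸
    isProbabilityMeasure_withDensity_div_integral hint (ae_of_all _ fun x => (Real.exp_pos _).le) hZ
  simp_rw [exp_neg_div_eq hZ] at hμ
  obtain ⟨C, hC⟩ :=
    (h.add_const (by linarith) (Real.log (∫ y, Real.exp (-V y)))).exists_hardyMomentBounds hα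
  have hsum := hC.add hC.map_neg
  rw [halfLineMeasure, ← withDensity_eq_add_map_neg (by fun_prop) (by simp [heven]), ← hμ] at hsum
  refine ⟨hprob, hsum.exists_satisfiesLSI ?_ ha hα hα2⟩
  rw [hμ]
  exact withDensity_absolutelyContinuous _ _

end HalfLinePotential

theorem one_add_rpow_le {α x : ℝ} (hα : 1 ≤ α) (hx : 0 ≤ x) :
    (1 + x) ^ α ≤ 2 ^ (α - 1) * (1 + x ^ α) := by
  have := NNReal.rpow_add_le_mul_rpow_add_rpow 1 ⟨x, hx⟩ hα
  rw [NNReal.one_rpow] at this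
  exact_mod_cast this

theorem rpow_sub_one_le {α x : ℝ} (hα : 1 ≤ α) (hx : 0 < x) :
    x ^ (α - 1) ≤ x ^ α / 2 + 2 ^ (α - 1) := by
  rcases le_total 2 x with h2x | hx2
  · calc x ^ (α - 1) = x ^ α / x := Real.rpow_sub_one hx.ne' α
      _ ≤ x ^ α / 2 := by gcongr
      _ ≤ _ := le_add_of_nonneg_right (by positivity)
  · calc x ^ (α - 1) ≤ 2 ^ (α - 1) := by gcongr
      _ ≤ _ := le_add_of_nonneg_left (by positivity)

theorem rpow_le_one_add_rpow {s α x : ℝ} (hs : 0 ≤ s) (hsα : s ≤ α) (hx : 0 ≤ x) :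
    x ^ s ≤ (1 + x) ^ α :=
  calc x ^ s ≤ (1 + x) ^ s := by gcongr; linarith
    _ ≤ _ := Real.rpow_le_rpow_of_exponent_le (by linarith) hsα

theorem halfLinePotential_gamma {α : ℝ} (hα : 1 ≤ α) (b : ℝ) :
    HalfLinePotential α (fun x => x ^ α - b * Real.log (1 + x))
      (fun x => α * x ^ α - b * (x / (1 + x))) where
  continuousOn := by
    have hne : ∀ x ∈ Ici (0 : ℝ), 1 + x ≠ 0 := fun x (hx : 0 ≤ x) => by positivity
    have hpow : Continuous fun x : ℝ => x ^ α := Real.continuous_rpow_const (by linarith)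
    fun_prop (disch := assumption)
  continuousOn_deriv := by
    have hne : ∀ x ∈ Ici (0 : ℝ), 1 + x ≠ 0 := fun x (hx : 0 ≤ x) => by positivity
    have hpow : Continuous fun x : ℝ => x ^ α := Real.continuous_rpow_const (by linarith)
    fun_prop (disch := assumption)
  hasDerivAt x hx := by
    have hne : 1 + x ≠ 0 := by positivity
    refine ((Real.hasDerivAt_rpow_const (p := α) (Or.inl hx.ne')).fun_sub
      ((((hasDerivAt_id' x).const_add 1).log hne).const_mul b)).congr_deriv ?_
    rw [Real.rpow_sub_one hx.ne']
    field_simp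
  exists_sub_le := by
    refine ⟨(2 ^ (α - 1))⁻¹, 1 + |b|, by positivity, by positivity, fun x hx => ?_⟩
    have hfrac : x / (1 + x) ≤ 1 := by rw [div_le_one (by positivity)]; linarith
    calc (2 ^ (α - 1))⁻¹ * (1 + x) ^ α - (1 + |b|)
        ≤ (1 + x ^ α) - (1 + |b|) := by
          gcongr
          rw [inv_mul_le_iff₀ (by positivity)]
          exact one_add_rpow_le hα hx.le
      _ = 1 * x ^ α - |b| * 1 := by ring
      _ ≤ α * x ^ α - |b| * (x / (1 + x)) := by gcongr
      _ ≤ α * x ^ α - b * (x / (1 + x)) := by gcongr; exact le_abs_self b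
  exists_le := by
    refine ⟨1 + |b|, by positivity, fun x hx => ?_⟩
    have hlog : Real.log (1 + x) ≤ (1 + x) ^ α := by
      have := rpow_le_one_add_rpow zero_le_one hα hx.le
      rw [Real.rpow_one] at this
      linarith [Real.log_le_sub_one_of_pos (show 0 < 1 + x by linarith)]
    have hlog0 : 0 ≤ Real.log (1 + x) := Real.log_nonneg (by linarith)
    calc x ^ α - b * Real.log (1 + x) = x ^ α + -b * Real.log (1 + x) := by ring
      _ ≤ (1 + x) ^ α + |b| * (1 + x) ^ α := by
        gcongr
        exacts [by linarith, neg_le_abs b]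
      _ = _ := by ring

theorem halfLinePotential_tau {α : ℝ} (hα : 1 < α) :
    HalfLinePotential α (fun x => |x| ^ α + |x| ^ (α - 1) * Real.cos x)
      (fun x => α * |x| ^ α + (α - 1) * |x| ^ (α - 1) * Real.cos x - |x| ^ α * Real.sin x) where
  continuousOn := by
    have hpow {s : ℝ} (hs : 0 ≤ s) : Continuous fun x : ℝ => |x| ^ s :=
      continuous_abs.rpow_const fun x => Or.inr hs
    have := hpow (show 0 ≤ α by linarith)
    have := hpow (show 0 ≤ α - 1 by linarith)
    fun_prop
  continuousOn_deriv := by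
    have hpow {s : ℝ} (hs : 0 ≤ s) : Continuous fun x : ℝ => |x| ^ s :=
      continuous_abs.rpow_const fun x => Or.inr hs
    have := hpow (show 0 ≤ α by linarith)
    have := hpow (show 0 ≤ α - 1 by linarith)
    fun_prop
  hasDerivAt x hx := by
    have hpow (s : ℝ) : HasDerivAt (fun x : ℝ => |x| ^ s) (s * x ^ (s - 1)) x :=
      (Real.hasDerivAt_rpow_const (Or.inl hx.ne')).congr_of_eventuallyEq <| by
        filter_upwards [lt_mem_nhds hx] with z hz
        rw [abs_of_pos hz]
    refine ((hpow α).fun_add ((hpow (α - 1)).fun_mul (Real.hasDerivAt_cos x))).congr_deriv ?_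
    rw [abs_of_pos hx, Real.rpow_sub_one hx.ne' (α - 1), Real.rpow_sub_one hx.ne' α]
    field_simp
    ring
  exists_sub_le := by
    refine ⟨(α - 1) / 2 * (2 ^ (α - 1))⁻¹, (α - 1) * (1 / 2 + 2 ^ (α - 1)), by positivity,
      by positivity, fun x hx => ?_⟩
    rw [abs_of_pos hx]
    have hgrowth : (2 ^ (α - 1))⁻¹ * (1 + x) ^ α ≤ 1 + x ^ α := by
      rw [inv_mul_le_iff₀ (by positivity)]
      exact one_add_rpow_le hα.le hx.le
    have hsin : x ^ α * Real.sin x ≤ x ^ α * 1 := by gcongr; exact Real.sin_le_one x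
    have hcos : (α - 1) * x ^ (α - 1) * -1 ≤ (α - 1) * x ^ (α - 1) * Real.cos x := by
      gcongr
      exact Real.neg_one_le_cos x
    calc (α - 1) / 2 * (2 ^ (α - 1))⁻¹ * (1 + x) ^ α - (α - 1) * (1 / 2 + 2 ^ (α - 1))
        = (α - 1) / 2 * ((2 ^ (α - 1))⁻¹ * (1 + x) ^ α) - (α - 1) * (1 / 2 + 2 ^ (α - 1)) := by
          ring
      _ ≤ (α - 1) / 2 * (1 + x ^ α) - (α - 1) * (1 / 2 + 2 ^ (α - 1)) := by gcongr
      _ = (α - 1) * x ^ α - (α - 1) * (x ^ α / 2 + 2 ^ (α - 1)) := by ring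
      _ ≤ (α - 1) * x ^ α - (α - 1) * x ^ (α - 1) := by gcongr; exact rpow_sub_one_le hα.le hx
      _ ≤ _ := by linarith
  exists_le := by
    refine ⟨2, zero_le_two, fun x hx => ?_⟩
    rw [abs_of_pos hx]
    calc x ^ α + x ^ (α - 1) * Real.cos x ≤ x ^ α + x ^ (α - 1) :=
          add_le_add_right (mul_le_of_le_one_right (by positivity) (Real.cos_le_one x)) _
      _ ≤ (1 + x) ^ α + (1 + x) ^ α := add_le_add
          (rpow_le_one_add_rpow (by linarith) le_rfl hx.le)
          (rpow_le_one_add_rpow (by linarith) (by linarith) hx.le)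
      _ = 2 * (1 + x) ^ α := (two_mul _).symm

theorem tauDensity_eq_exp (α x : ℝ) :
    tauDensity α x = Real.exp (-(|x| ^ α + |x| ^ (α - 1) * Real.cos x)) := by
  rw [tauDensity, neg_add, sub_eq_add_neg]

theorem gammaDensity_eq_exp (α b : ℝ) {x : ℝ} (hx : 0 < x) :
    gammaDensity α b x = Real.exp (-(x ^ α - b * Real.log (1 + x))) := by
  rw [gammaDensity, Real.rpow_def_of_pos (by linarith), ← Real.exp_add]
  ring_nf

theorem tau_eq_withDensity_exp (α : ℝ) :
    tau α = volume.withDensity fun x =>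
      ENNReal.ofReal (Real.exp (-(|x| ^ α + |x| ^ (α - 1) * Real.cos x)) /
        ∫ y, Real.exp (-(|y| ^ α + |y| ^ (α - 1) * Real.cos y))) := by
  simp only [tau, tauDensity_eq_exp]

theorem gamma_eq_withDensity_exp (α b : ℝ) :
    gamma α b = (volume.restrict (Ioi 0)).withDensity fun x =>
      ENNReal.ofReal (Real.exp (-(x ^ α - b * Real.log (1 + x))) /
        ∫ y in Ioi 0, Real.exp (-(y ^ α - b * Real.log (1 + y)))) := by
  rw [gamma, Measure.restrict_congr_set Ioi_ae_eq_Ici.symm,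
    setIntegral_congr_fun measurableSet_Ioi fun y hy => gammaDensity_eq_exp α b hy]
  refine withDensity_congr_ae ?_
  filter_upwards [ae_restrict_mem measurableSet_Ioi] with x hx
  rw [gammaDensity_eq_exp α b hx]

end ModLSI

theorem mainTheorem7_general {a α : ℝ} (ha : 0 < a) (hα : 1 < α) (hα2 : α ≤ 2) :
    (IsProbabilityMeasure (ModLSI.tau α) ∧
      ∃ C : ℝ, 0 < C ∧ ModLSI.SatisfiesLSI a α C (ModLSI.tau α)) ∧
    ∀ b : ℝ, IsProbabilityMeasure (ModLSI.gamma α b) ∧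
      ∃ C : ℝ, 0 < C ∧ ModLSI.SatisfiesLSI a α C (ModLSI.gamma α b) :=
  ⟨(ModLSI.halfLinePotential_tau hα).isProbabilityMeasure_and_exists_satisfiesLSI_of_even
      (fun x => by simp only [abs_neg, Real.cos_neg]) ha hα hα2 (ModLSI.tau_eq_withDensity_exp α),
    fun b => (ModLSI.halfLinePotential_gamma hα.le b).isProbabilityMeasure_and_exists_satisfiesLSI
      ha hα hα2 (ModLSI.gamma_eq_withDensity_exp α b)⟩

theorem mainTheorem7 :
    ∃ a : ℝ, 0 < a ∧ ∀ α : ℝ, 1 < α → α ≤ 2 →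
      (IsProbabilityMeasure (ModLSI.tau α) ∧
        ∃ C : ℝ, 0 < C ∧ ModLSI.SatisfiesLSI a α C (ModLSI.tau α)) ∧
      (∀ b : ℝ, IsProbabilityMeasure (ModLSI.gamma α b) ∧
        ∃ C : ℝ, 0 < C ∧ ModLSI.SatisfiesLSI a α C (ModLSI.gamma α b)) :=
  ⟨1, one_pos, fun _ hα hα2 => mainTheorem7_general one_pos hα hα2⟩
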